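/- For $m\ge 1$ let $\mathrm H_m$ be the real vector space of $m\times m$ complex Hermitian matrices and let $\mathcal P_m\subseteq \mathrm H_m$ be the set of pure states, i.e. of Hermitian matrices of rank one and trace one. Let $k>1$, let $n_1\ge\cdots\ge n_k\ge 2$ be integers, put $N=\prod_{i=1}^k n_i$, and identify $\mathrm H_N$ with $\bigotimes_{i=1}^k \mathrm H_{n_i}$ through the Kronecker product. Write $\otimes_{i=1}^k\mathcal P_{n_i}=\{P_1\otimes\cdots\otimes P_k : P_i\in\mathcal P_{n_i},\ i=1,\dots,k\}$ for the set of product pure states. Let $\Psi:\mathrm H_N\to\mathrm H_N$ be a real-linear map. The following are equivalent. (a) $\Psi\left(\otimes_{i=1}^k\mathcal P_{n_i}\right)=\otimes_{i=1}^k\mathcal P_{n_i}$. (b) $\Psi\left(\operatorname{conv}(\otimes_{i=1}^k\mathcal P_{n_i})\right)=\operatorname{conv}\left(\otimes_{i=1}^k\mathcal P_{n_i}\right)$, i.e. $\Psi$ maps the set of separable states onto itself. (c) There are a permutation $\pi$ of $\{1,\dots,k\}$ with $n_{\pi(i)}=n_i$ for all $i$, and real-linear maps $\psi_i$ on $\mathrm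 H_{n_i}$ for $i=1,\dots,k$, such that $$\Psi(A_1\otimes\cdots\otimes A_k)=\psi_1(A_{\pi(1)})\otimes\cdots\otimes\psi_k(A_{\pi(k)})\quad\text{for all } A_i\in\mathrm H_{n_i},\ i=1,\dots,k,$$ where, for each $i$, $\psi_i$ has the form $X\mapsto U_iXU_i^*$ or $X\mapsto U_iX^{T}U_i^*$ for some unitary $n_i\times n_i$ complex matrix $U_i$. -/

import Mathlib

open scoped Matrix

/-- The real vector space of complex Hermitian matrices with rows and columns indexed by `ι`. -/
abbrev Herm (ι : Type) [Fintype ι] [DecidableEq ι] : Type :=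
  selfAdjoint (Matrix ι ι ℂ)

/-- Pure states: Hermitian matrices of rank one and trace one. -/
def pureStates (ι : Type) [Fintype ι] [DecidableEq ι] : Set (Herm ι) :=
  {P | (P : Matrix ι ι ℂ).rank = 1 ∧ (P : Matrix ι ι ℂ).trace = 1}

/-- Index set of the standard product basis of `ℂ^{n_1} ⊗ ⋯ ⊗ ℂ^{n_k}`; it has `∏ i, n i`
elements. -/
abbrev ProdIdx {k : ℕ} (n : Fin k → ℕ) : Type := (i : Fin k) → Fin (n i)

/-- The tensor (Kronecker) product `A_1 ⊗ ⋯ ⊗ A_k` of Hermitian matrices, in the product basis. -/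
def tensorHerm {k : ℕ} {n : Fin k → ℕ} (A : (i : Fin k) → Herm (Fin (n i))) :
    Herm (ProdIdx n) :=
  ⟨Matrix.of fun a b => ∏ i, (A i : Matrix (Fin (n i)) (Fin (n i)) ℂ) (a i) (b i), by
    rw [selfAdjoint.mem_iff]
    ext a b
    rw [Matrix.star_apply, Matrix.of_apply, Matrix.of_apply, star_prod]
    refine Finset.prod_congr rfl fun i _ => ?_
    rw [← Matrix.star_apply, selfAdjoint.mem_iff.mp (A i).2]⟩

/-- Product pure states `P_1 ⊗ ⋯ ⊗ P_k`. -/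
def productPureStates {k : ℕ} (n : Fin k → ℕ) : Set (Herm (ProdIdx n)) :=
  {T | ∃ P : (i : Fin k) → Herm (Fin (n i)),
    (∀ i, P i ∈ pureStates (Fin (n i))) ∧ T = tensorHerm P}

/-- Separable states: the convex hull of the product pure states. -/
def separableStates {k : ℕ} (n : Fin k → ℕ) : Set (Herm (ProdIdx n)) :=
  convexHull ℝ (productPureStates n)

/-- The identification of Hermitian matrices of equal sizes `m = n`. -/
def castHerm {m n : ℕ} (h : m = n) (A : Herm (Fin m)) : Herm (Fin n) :=
  ⟨(A : Matrix (Fin m) (Fin m) ℂ).submatrix (Fin.cast h.symm) (Fin.cast h.symm), by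
    subst h
    exact A.2⟩

/-- `ψ` is `X ↦ U X U*` for a unitary `U`, or `X ↦ U Xᵀ U*` for a unitary `U`. -/
def IsUnitaryConjOrTranspose {m : ℕ} (ψ : Herm (Fin m) →ₗ[ℝ] Herm (Fin m)) : Prop :=
  ∃ U ∈ Matrix.unitaryGroup (Fin m) ℂ,
    (∀ X, (ψ X : Matrix (Fin m) (Fin m) ℂ) = U * (X : Matrix (Fin m) (Fin m) ℂ) * Uᴴ) ∨
    (∀ X, (ψ X : Matrix (Fin m) (Fin m) ℂ) = U * (X : Matrix (Fin m) (Fin m) ℂ)ᵀ * Uᴴ)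

/-!
For the Hilbert–Schmidt norm the product pure states are unit vectors, so they are the extreme
points of the set of separable states, and they span the whole space; hence `Ψ` is bijective and
permutes them as soon as it preserves either set.

For distinct product pure states `P` and `Q`, the sum `P + Q` has another decomposition as a sum of
two product pure states exactly when `P` and `Q` differ in a single factor. As `Ψ` is linear and
bijective, it preserves this relation, so it induces an automorphism of the Hamming graph of tuples
of pure states. Such an automorphism permutes the coordinates and acts on each of them separately,
and a partial trace shows that the action on each coordinate extends to a real-linear map.

What remains is a Wigner-type theorem. The `2 × 2` minors of the complexification `φ` of such a map
vanish on all matrices `x x*`, hence by polarization on all matrices `x y*`. For a fixed unit vector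
`o` with `φ (o o*) = u u*`, the matrices `φ (w o*)` are then either all of the form `a u*` or all of
the form `u b*`; in the first case `w ↦ φ (w o*) u` is the isometry implementing the map, and the
second case reduces to the first by transposition.
-/

section MultilinearSpan

variable {ι R : Type*} [Finite ι] [CommSemiring R] {M : ι → Type*} [∀ i, AddCommMonoid (M i)]
  [∀ i, Module R (M i)] {N : Type*} [AddCommMonoid N] [Module R N]

theorem multilinearMap_ext_of_span_eq_top {f g : MultilinearMap R M N} {s : (i : ι) → Set (M i)}
    (hs : ∀ i, Submodule.span R (s i) = ⊤) (h : ∀ m, (∀ i, m i ∈ s i) → f m = g m) : f = g := by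
  classical
  have := Fintype.ofFinite ι
  have key (t : Finset ι) : ∀ m : (i : ι) → M i, (∀ i ∉ t, m i ∈ s i) → f m = g m := by
    induction t using Finset.induction_on with
    | empty => exact fun m hm => h m fun i => hm i (Finset.notMem_empty i)
    | insert i t _ ih =>
      intro m hm
      have hi : f.toLinearMap m i = g.toLinearMap m i := by
        refine LinearMap.ext_on (hs i) fun x hx => ih _ fun j hj => ?_
        obtain rfl | hji := eq_or_ne j i
        · rwa [Function.update_self]
        · rw [Function.update_of_ne hji]
          exact hm j (by simp [hji, hj])
      simpa using LinearMap.congr_fun hi (m i)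
  exact MultilinearMap.ext fun m => key Finset.univ m (by simp)

end MultilinearSpan

section Kronecker

variable {ι R : Type*} [Fintype ι] [CommSemiring R] {κ : ι → Type*}

variable (R κ) in
/-- The Kronecker product of a finite family of square matrices, as a multilinear map. -/
def piKronecker :
    MultilinearMap R (fun i => Matrix (κ i) (κ i) R) (Matrix (∀ i, κ i) (∀ i, κ i) R) :=
  (Matrix.ofLinearEquiv R).toLinearMap.compMultilinearMap <|
    MultilinearMap.pi fun a => MultilinearMap.pi fun b =>
      (MultilinearMap.mkPiAlgebra R ι R).compLinearMap fun i =>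
        Matrix.entryLinearMap R R (a i) (b i)

theorem piKronecker_apply (A : ∀ i, Matrix (κ i) (κ i) R) (a b : ∀ i, κ i) :
    piKronecker R κ A a b = ∏ i, A i (a i) (b i) := by
  simp [piKronecker]

theorem piKronecker_single_one [∀ i, DecidableEq (κ i)] (a b : ∀ i, κ i) :
    piKronecker R κ (fun i => Matrix.single (a i) (b i) 1) = Matrix.single a b 1 := by
  classical
  ext c d
  simp only [piKronecker_apply, Matrix.single_apply]
  rw [Finset.prod_ite_zero]
  simp [funext_iff, forall_and]

theorem trace_piKronecker_mul [DecidableEq ι] [∀ i, Fintype (κ i)]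
    (A B : ∀ i, Matrix (κ i) (κ i) R) :
    (piKronecker R κ A * piKronecker R κ B).trace = ∏ i, (A i * B i).trace := by
  simp only [Matrix.trace, Matrix.diag_apply, Matrix.mul_apply, piKronecker_apply,
    Fintype.prod_sum, Finset.prod_mul_distrib]

end Kronecker

theorem eq_zero_of_rank_eq_zero {K m n : Type*} [Field K] [Finite m] [Fintype n] {A : Matrix m n K}
    (h : A.rank = 0) : A = 0 := by
  classical
  have hrange : LinearMap.range (Matrix.toLin' A) = ⊥ := Submodule.finrank_eq_zero.1 h
  exact Matrix.toLin'.map_eq_zero_iff.1 (LinearMap.range_eq_bot.1 hrange)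

section PureStates

variable {ι : Type} [Fintype ι] [DecidableEq ι]

theorem isHermitian_coe (A : Herm ι) : (A : Matrix ι ι ℂ).IsHermitian := A.2

/-- The Hermitian matrix `x x*`. -/
def outerHerm (x : ι → ℂ) : Herm ι :=
  ⟨Matrix.vecMulVec x (star x), Matrix.conjTranspose_vecMulVec x (star x) |>.trans <| by
    rw [star_star]⟩

theorem coe_outerHerm (x : ι → ℂ) :
    (outerHerm x : Matrix ι ι ℂ) = Matrix.vecMulVec x (star x) := rfl

theorem exists_eq_sum_outerHerm (A : Herm ι) :
    ∃ v : ι → ι → ℂ, (∀ i, v i ⬝ᵥ star (v i) = 1) ∧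
      A = ∑ i, (isHermitian_coe A).eigenvalues i • outerHerm (v i) := by
  set hA := isHermitian_coe A
  refine ⟨fun i => ⇑(hA.eigenvectorBasis i), fun i => ?_, Subtype.ext ?_⟩
  · rw [← EuclideanSpace.inner_eq_star_dotProduct, inner_self_eq_norm_sq_to_K,
      hA.eigenvectorBasis.orthonormal.1 i]
    simp
  · conv_lhs => rw [hA.spectral_theorem]
    ext a b
    rw [Unitary.conjStarAlgAut_apply, Matrix.mul_apply]
    simp only [Matrix.mul_diagonal,
      Function.comp_apply, Matrix.star_apply, Matrix.IsHermitian.eigenvectorUnitary_apply,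
      AddSubgroup.val_finsetSum, Matrix.sum_apply, selfAdjoint.val_smul, Matrix.smul_apply,
      coe_outerHerm, Matrix.vecMulVec_apply, Pi.star_apply, Complex.real_smul,
      Complex.coe_algebraMap]
    exact Finset.sum_congr rfl fun i _ => by ring

theorem trace_outerHerm (x : ι → ℂ) : (outerHerm x : Matrix ι ι ℂ).trace = x ⬝ᵥ star x :=
  Matrix.trace_vecMulVec x (star x)

theorem outerHerm_mem_pureStates {x : ι → ℂ} (hx : x ⬝ᵥ star x = 1) :
    outerHerm x ∈ pureStates ι := by
  have htrace : (outerHerm x : Matrix ι ι ℂ).trace = 1 := (trace_outerHerm x).trans hx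
  refine ⟨le_antisymm (Matrix.rank_vecMulVec_le _ _) (Nat.one_le_iff_ne_zero.2 fun h => ?_), htrace⟩
  rw [eq_zero_of_rank_eq_zero h, Matrix.trace_zero] at htrace
  exact zero_ne_one htrace

theorem mem_pureStates_iff {P : Herm ι} :
    P ∈ pureStates ι ↔ ∃ x : ι → ℂ, x ⬝ᵥ star x = 1 ∧ P = outerHerm x := by
  refine ⟨fun ⟨hrank, htrace⟩ => ?_, fun ⟨x, hx, hP⟩ => hP ▸ outerHerm_mem_pureStates hx⟩
  obtain ⟨v, hv, hP⟩ := exists_eq_sum_outerHerm P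
  set hA := isHermitian_coe P
  obtain ⟨⟨i, hi⟩, hunique⟩ :=
    Fintype.card_eq_one_iff.1 (hA.rank_eq_card_non_zero_eigs.symm.trans hrank)
  have hzero (j : ι) (hj : j ≠ i) : hA.eigenvalues j = 0 := by
    by_contra h
    exact hj (congrArg Subtype.val (hunique ⟨j, h⟩))
  have hone : hA.eigenvalues i = 1 := by
    rw [hA.trace_eq_sum_eigenvalues, Fintype.sum_eq_single i fun j hj => by simp [hzero j hj]]
      at htrace
    exact Complex.ofReal_eq_one.1 htrace
  refine ⟨v i, hv i, ?_⟩
  rw [hP, Fintype.sum_eq_single i fun j hj => by rw [hzero j hj, zero_smul], hone, one_smul]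

theorem span_pureStates : Submodule.span ℝ (pureStates ι) = ⊤ := by
  refine eq_top_iff.2 fun A _ => ?_
  obtain ⟨v, hv, hA⟩ := exists_eq_sum_outerHerm A
  rw [hA]
  exact Submodule.sum_mem _ fun i _ =>
    Submodule.smul_mem _ _ (Submodule.subset_span (outerHerm_mem_pureStates (hv i)))

theorem span_image_coe_of_span_eq_top {S : Set (Herm ι)} (hS : Submodule.span ℝ S = ⊤) :
    Submodule.span ℂ ((↑) '' S : Set (Matrix ι ι ℂ)) = ⊤ := by
  set T : Submodule ℂ (Matrix ι ι ℂ) := Submodule.span ℂ ((↑) '' S)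
  have hle : Submodule.span ℝ S ≤
      (T.restrictScalars ℝ).comap (selfAdjoint.submodule ℝ (Matrix ι ι ℂ)).subtype :=
    Submodule.span_le.2 fun A hA => Submodule.subset_span ⟨A, hA, rfl⟩
  have hmem (A : Herm ι) : (A : Matrix ι ι ℂ) ∈ T := hle (hS ▸ Submodule.mem_top)
  refine eq_top_iff.2 fun M _ => ?_
  rw [← realPart_add_I_smul_imaginaryPart M]
  exact Submodule.add_mem _ (hmem _) (Submodule.smul_mem _ _ (hmem _))

end PureStates

section HilbertSchmidt

open scoped Matrix.Norms.Frobenius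

variable {ι : Type} [Fintype ι] [DecidableEq ι]

theorem ofReal_re_trace_mul (A B : Herm ι) :
    ((((A : Matrix ι ι ℂ) * B).trace.re : ℝ) : ℂ) = ((A : Matrix ι ι ℂ) * B).trace := by
  refine Complex.conj_eq_iff_re.1 ?_
  rw [starRingEnd_apply, ← Matrix.trace_conjTranspose, Matrix.conjTranspose_mul,
    (isHermitian_coe A).eq, (isHermitian_coe B).eq, Matrix.trace_mul_comm]

theorem norm_sq_eq_re_trace_mul_self (A : Herm ι) :
    ‖A‖ ^ 2 = ((A : Matrix ι ι ℂ) * A).trace.re := by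
  rw [AddSubgroup.coe_norm, Matrix.frobenius_norm_def, ← Real.sqrt_eq_rpow,
    Real.sq_sqrt (by positivity)]
  simp only [Matrix.trace, Matrix.diag_apply, Matrix.mul_apply, Complex.re_sum]
  refine Finset.sum_congr rfl fun i _ => Finset.sum_congr rfl fun j _ => ?_
  rw [← (isHermitian_coe A).apply j i, ← starRingEnd_apply, Complex.mul_conj,
    Complex.normSq_eq_norm_sq, Complex.ofReal_re, Real.rpow_two]

/-- The Hilbert–Schmidt inner product `⟪A, B⟫ = tr (A B)` on Hermitian matrices, compatible with
the Frobenius norm. -/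
noncomputable instance : InnerProductSpace ℝ (Herm ι) where
  inner A B := ((A : Matrix ι ι ℂ) * B).trace.re
  norm_sq_eq_re_inner := norm_sq_eq_re_trace_mul_self
  conj_inner_symm A B := by rw [Matrix.trace_mul_comm, conj_trivial]
  add_left A B C := by rw [AddSubgroup.coe_add, add_mul, Matrix.trace_add, Complex.add_re]
  smul_left A B r := by
    rw [selfAdjoint.val_smul, smul_mul_assoc, Matrix.trace_smul, Complex.smul_re, conj_trivial,
      smul_eq_mul]

theorem coe_inner (A B : Herm ι) :
    ((inner ℝ A B : ℝ) : ℂ) = ((A : Matrix ι ι ℂ) * B).trace :=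
  ofReal_re_trace_mul A B

instance : FiniteDimensional ℝ (Herm ι) :=
  inferInstanceAs (FiniteDimensional ℝ (selfAdjoint.submodule ℝ (Matrix ι ι ℂ)))

theorem inner_outerHerm (x y : ι → ℂ) :
    inner ℝ (outerHerm x) (outerHerm y) = Complex.normSq (x ⬝ᵥ star y) := by
  rw [← Complex.ofReal_inj, coe_inner, coe_outerHerm, coe_outerHerm,
    Matrix.vecMulVec_mul_vecMulVec, Matrix.vecMulVec_smul, Matrix.trace_smul,
    Matrix.trace_vecMulVec, smul_eq_mul, ← Complex.mul_conj, starRingEnd_apply,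
    Matrix.star_dotProduct, dotProduct_comm (star y), mul_comm]

theorem norm_eq_one_of_mem_pureStates {P : Herm ι} (hP : P ∈ pureStates ι) : ‖P‖ = 1 := by
  obtain ⟨x, hx, rfl⟩ := mem_pureStates_iff.1 hP
  rw [← sq_eq_sq₀ (norm_nonneg _) zero_le_one, ← real_inner_self_eq_norm_sq, inner_outerHerm, hx]
  simp

theorem inner_one_of_mem_pureStates {P : Herm ι} (hP : P ∈ pureStates ι) :
    inner ℝ P 1 = (1 : ℝ) := by
  rw [← Complex.ofReal_inj, coe_inner, selfAdjoint.val_one, mul_one, hP.2, Complex.ofReal_one]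

end HilbertSchmidt

section TensorProduct

open scoped Matrix.Norms.Frobenius

variable {k : ℕ} {n : Fin k → ℕ}

theorem coe_tensorHerm (A : (i : Fin k) → Herm (Fin (n i))) :
    (tensorHerm A : Matrix (ProdIdx n) (ProdIdx n) ℂ) =
      piKronecker ℂ (fun i => Fin (n i)) fun i => (A i : Matrix (Fin (n i)) (Fin (n i)) ℂ) := by
  ext a b
  rw [piKronecker_apply]
  rfl

variable (n) in
/-- The Kronecker product of Hermitian matrices, as a real-multilinear map. -/
noncomputable def tensorHermMap :
    MultilinearMap ℝ (fun i => Herm (Fin (n i))) (Herm (ProdIdx n)) :=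
  MultilinearMap.codRestrict
    (((piKronecker ℂ fun i => Fin (n i)).restrictScalars ℝ).compLinearMap fun i =>
      (selfAdjoint.submodule ℝ (Matrix (Fin (n i)) (Fin (n i)) ℂ)).subtype)
    (selfAdjoint.submodule ℝ (Matrix (ProdIdx n) (ProdIdx n) ℂ)) fun A =>
      coe_tensorHerm A ▸ (tensorHerm A).2

theorem tensorHermMap_apply (A : (i : Fin k) → Herm (Fin (n i))) :
    tensorHermMap n A = tensorHerm A :=
  Subtype.ext (coe_tensorHerm A).symm

theorem inner_tensorHerm (A B : (i : Fin k) → Herm (Fin (n i))) :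
    inner ℝ (tensorHerm A) (tensorHerm B) = ∏ i, inner ℝ (A i) (B i) := by
  rw [← Complex.ofReal_inj, coe_inner, coe_tensorHerm, coe_tensorHerm, trace_piKronecker_mul,
    Complex.ofReal_prod]
  simp only [coe_inner]

theorem span_productPureStates : Submodule.span ℝ (productPureStates n) = ⊤ := by
  rw [← Submodule.orthogonal_eq_bot_iff, eq_bot_iff]
  intro A hA
  let traceMul : Matrix (ProdIdx n) (ProdIdx n) ℂ →ₗ[ℂ] ℂ :=
    Matrix.traceLinearMap _ ℂ ℂ ∘ₗ LinearMap.mulLeft ℂ (A : Matrix (ProdIdx n) (ProdIdx n) ℂ)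
  have hzero : traceMul.compMultilinearMap (piKronecker ℂ fun i => Fin (n i)) = 0 := by
    refine multilinearMap_ext_of_span_eq_top
      (fun i => span_image_coe_of_span_eq_top span_pureStates) fun m hm => ?_
    choose P hP hPm using hm
    obtain rfl : (fun i => (P i : Matrix (Fin (n i)) (Fin (n i)) ℂ)) = m := funext hPm
    have := (Submodule.mem_orthogonal' _ _).1 hA _ (Submodule.subset_span ⟨P, hP, rfl⟩)
    simp [traceMul, ← coe_tensorHerm, ← coe_inner, this]
  ext a b
  simpa [traceMul, piKronecker_single_one, Matrix.trace_mul_single] using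
    congr($hzero fun i => Matrix.single (b i) (a i) 1)

end TensorProduct

section Rigidity

variable {E F : Type*} [NormedAddCommGroup E] [InnerProductSpace ℝ E] [NormedAddCommGroup F]
  [InnerProductSpace ℝ F]

open scoped RealInnerProductSpace

theorem eq_or_eq_neg_of_forall_inner_mul_inner {x y : E} {v w : F} (hx : x ≠ 0) (hv : v ≠ 0)
    (hnorm : ‖x‖ = ‖y‖) (h : ∀ a b, ⟪x, a⟫ * ⟪v, b⟫ = ⟪y, a⟫ * ⟪w, b⟫) :
    (y = x ∧ w = v) ∨ (y = -x ∧ w = -v) := by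
  have hsmul : ⟪v, v⟫ • x = ⟪w, v⟫ • y := ext_inner_right ℝ fun a => by
    rw [real_inner_smul_left, real_inner_smul_left, mul_comm, h, mul_comm]
  have hvv : ⟪v, v⟫ ≠ 0 := inner_self_ne_zero.2 hv
  have hxx : ⟪x, x⟫ ≠ 0 := inner_self_ne_zero.2 hx
  have habs : |⟪v, v⟫| = |⟪w, v⟫| := by
    have := congrArg norm hsmul
    rw [norm_smul, norm_smul, ← hnorm] at this
    exact mul_right_cancel₀ (norm_ne_zero_iff.2 hx) this
  obtain heq | hneg := abs_eq_abs.1 habs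
  · obtain rfl : x = y := smul_right_injective E hvv (hsmul.trans (by rw [heq]))
    exact Or.inl ⟨rfl, ext_inner_right ℝ fun b => (mul_left_cancel₀ hxx (h x b)).symm⟩
  · obtain rfl : y = -x := smul_right_injective E hvv <| by
      simp only [smul_neg, hsmul]
      rw [hneg, neg_smul]
    refine Or.inr ⟨rfl, ext_inner_right ℝ fun b => mul_left_cancel₀ hxx ?_⟩
    rw [inner_neg_left, mul_neg, h x b, inner_neg_left, neg_mul, neg_neg]

theorem norm_sub_eq_norm_sub_of_add_eq_add {a b c d : E} (ha : ‖a‖ = 1) (hb : ‖b‖ = 1)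
    (hc : ‖c‖ = 1) (hd : ‖d‖ = 1) (h : a + b = c + d) : ‖a - b‖ = ‖c - d‖ := by
  have hab := parallelogram_law_with_norm ℝ a b
  have hcd := parallelogram_law_with_norm ℝ c d
  rw [ha, hb, h] at hab
  rw [hc, hd] at hcd
  exact (mul_self_inj (norm_nonneg _) (norm_nonneg _)).1 (by linarith)

theorem eq_of_add_self_eq_add {a c d : E} (ha : ‖a‖ = 1) (hc : ‖c‖ = 1) (hd : ‖d‖ = 1)
    (h : a + a = c + d) : c = a := by
  have hcd : c = d := by
    rw [← sub_eq_zero, ← norm_eq_zero, ← norm_sub_eq_norm_sub_of_add_eq_add ha ha hc hd h,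
      sub_self, norm_zero]
  rw [← hcd, ← two_smul ℝ, ← two_smul ℝ] at h
  exact (smul_right_injective E two_ne_zero h).symm

theorem eq_of_add_eq_add_of_sub_eq_sub {M : Type*} [AddCommGroup M] [Module ℝ M] {a b c d : M}
    (hadd : a + b = c + d) (hsub : c - d = a - b) : c = a := by
  refine smul_right_injective M (two_ne_zero (α := ℝ)) ?_
  calc (2 : ℝ) • c = (c + d) + (c - d) := by module
    _ = (2 : ℝ) • a := by rw [← hadd, hsub]; module

theorem eq_or_eq_of_forall_add_inner_mul_inner {a b c d : E} {u v w z : F} (ha : ‖a‖ = 1)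
    (hb : ‖b‖ = 1) (hc : ‖c‖ = 1) (hd : ‖d‖ = 1) (hab : a ≠ b) (huv : u ≠ v)
    (hE : a + b = c + d) (hF : u + v = w + z)
    (h : ∀ x y, ⟪a, x⟫ * ⟪u, y⟫ + ⟪b, x⟫ * ⟪v, y⟫ = ⟪c, x⟫ * ⟪w, y⟫ + ⟪d, x⟫ * ⟪z, y⟫) :
    (c = a ∧ w = u) ∨ (c = b ∧ w = v) := by
  have hsub (x : E) (y : F) : ⟪a - b, x⟫ * ⟪u - v, y⟫ = ⟪c - d, x⟫ * ⟪w - z, y⟫ := by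
    have hEx := congr(⟪$hE, x⟫)
    have hFy := congr(⟪$hF, y⟫)
    simp only [inner_add_left, inner_sub_left] at hEx hFy ⊢
    linear_combination 2 * h x y - hEx * (⟪u, y⟫ + ⟪v, y⟫) - hFy * (⟪c, x⟫ + ⟪d, x⟫)
  obtain ⟨hcd, hwz⟩ | ⟨hcd, hwz⟩ := eq_or_eq_neg_of_forall_inner_mul_inner (sub_ne_zero.2 hab)
    (sub_ne_zero.2 huv) (norm_sub_eq_norm_sub_of_add_eq_add ha hb hc hd hE) hsub
  · exact Or.inl ⟨eq_of_add_eq_add_of_sub_eq_sub hE hcd, eq_of_add_eq_add_of_sub_eq_sub hF hwz⟩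
  · rw [neg_sub] at hcd hwz
    rw [add_comm] at hE hF
    exact Or.inr ⟨eq_of_add_eq_add_of_sub_eq_sub hE hcd, eq_of_add_eq_add_of_sub_eq_sub hF hwz⟩

end Rigidity

section SumOfPureStates

open scoped Matrix.Norms.Frobenius

variable {ι : Type} [Fintype ι] [DecidableEq ι]

theorem outerHerm_smul (c : ℂ) (x : ι → ℂ) :
    outerHerm (c • x) = Complex.normSq c • outerHerm x := by
  apply Subtype.ext
  rw [selfAdjoint.val_smul, coe_outerHerm, coe_outerHerm, star_smul, Matrix.smul_vecMulVec,
    Matrix.vecMulVec_smul, smul_smul, ← Complex.coe_smul, ← Complex.mul_conj, Complex.star_def]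

omit [DecidableEq ι] in
theorem smul_dotProduct_star_smul (c : ℂ) (x : ι → ℂ) :
    (c • x) ⬝ᵥ star (c • x) = Complex.normSq c * (x ⬝ᵥ star x) := by
  rw [star_smul, smul_dotProduct, dotProduct_smul, smul_smul, ← Complex.mul_conj,
    Complex.star_def, smul_eq_mul]

theorem outerHerm_add_add_outerHerm_sub (x y : ι → ℂ) :
    outerHerm (x + y) + outerHerm (x - y) = (2 : ℝ) • (outerHerm x + outerHerm y) := by
  apply Subtype.ext
  simp only [AddSubgroup.coe_add, selfAdjoint.val_smul, coe_outerHerm, star_add, star_sub,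
    Matrix.add_vecMulVec, Matrix.vecMulVec_add, Matrix.sub_vecMulVec, Matrix.vecMulVec_sub]
  module

theorem exists_phase_re_eq_zero (z : ℂ) : ∃ η : ℂ, Complex.normSq η = 1 ∧ (star η * z).re = 0 := by
  obtain ⟨u, hu, hz⟩ := Complex.exists_norm_eq_mul_self z
  refine ⟨star (Complex.I * u), ?_, ?_⟩
  · simp [Complex.normSq_eq_norm_sq, hu]
  · rw [star_star, mul_assoc, ← hz, Complex.I_mul_re, Complex.ofReal_im, neg_zero]

theorem exists_outerHerm_eq_and_re_dotProduct_eq_zero (x y : ι → ℂ) :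
    ∃ w, outerHerm w = outerHerm y ∧ w ⬝ᵥ star w = y ⬝ᵥ star y ∧ (x ⬝ᵥ star w).re = 0 := by
  obtain ⟨η, hη, hre⟩ := exists_phase_re_eq_zero (x ⬝ᵥ star y)
  refine ⟨η • y, by rw [outerHerm_smul, hη, one_smul], ?_, ?_⟩
  · rw [smul_dotProduct_star_smul, hη, Complex.ofReal_one, one_mul]
  · rwa [star_smul, dotProduct_smul, smul_eq_mul]

theorem outerHerm_smul_add_mem_pureStates {x y : ι → ℂ} {s : ℂ} (hx : x ⬝ᵥ star x = 1)
    (hy : y ⬝ᵥ star y = 1) (hxy : x ⬝ᵥ star y + y ⬝ᵥ star x = 0)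
    (hs : Complex.normSq s = 1 / 2) : outerHerm (s • (x + y)) ∈ pureStates ι :=
  outerHerm_mem_pureStates <| by
    rw [smul_dotProduct_star_smul, hs, star_add, add_dotProduct, dotProduct_add, dotProduct_add]
    push_cast
    linear_combination (hx + hy + hxy) / 2

/-- For unit vectors `x`, `y` with `⟪x, y⟫` purely imaginary, `(x ± y) / √2` are unit vectors whose
pure states add up to those of `x` and `y`. -/
theorem exists_add_eq_add {P Q : Herm ι} (hP : P ∈ pureStates ι) (hQ : Q ∈ pureStates ι)
    (hPQ : P ≠ Q) : ∃ R ∈ pureStates ι, ∃ R' ∈ pureStates ι, R ≠ P ∧ R ≠ Q ∧ P + Q = R + R' := by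
  obtain ⟨x, hx, rfl⟩ := mem_pureStates_iff.1 hP
  obtain ⟨y, hy, rfl⟩ := mem_pureStates_iff.1 hQ
  obtain ⟨w, hwy, hw, hre⟩ := exists_outerHerm_eq_and_re_dotProduct_eq_zero x y
  rw [hy] at hw
  rw [← hwy] at hQ hPQ ⊢
  have hwx : w ⬝ᵥ star x = star (x ⬝ᵥ star w) := by
    rw [← Matrix.star_dotProduct_star, star_star, dotProduct_comm]
  have hxw : x ⬝ᵥ star w + w ⬝ᵥ star x = 0 := by
    rw [hwx, Complex.star_def, Complex.add_conj, hre, mul_zero, Complex.ofReal_zero]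
  obtain ⟨s, hs⟩ : ∃ s : ℂ, Complex.normSq s = 1 / 2 :=
    ⟨(√(1 / 2) : ℝ), by rw [Complex.normSq_ofReal, Real.mul_self_sqrt (by norm_num)]⟩
  have hR : outerHerm (s • (x + w)) ∈ pureStates ι :=
    outerHerm_smul_add_mem_pureStates hx hw hxw hs
  have hR' : outerHerm (s • (x - w)) ∈ pureStates ι := by
    rw [sub_eq_add_neg]
    refine outerHerm_smul_add_mem_pureStates hx ?_ ?_ hs
    · rw [star_neg, neg_dotProduct_neg, hw]
    · rw [star_neg, dotProduct_neg, neg_dotProduct, ← neg_add, hxw, neg_zero]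
  have hsum : outerHerm x + outerHerm w = outerHerm (s • (x + w)) + outerHerm (s • (x - w)) := by
    rw [outerHerm_smul, outerHerm_smul, ← smul_add, outerHerm_add_add_outerHerm_sub, hs, smul_smul]
    norm_num
  have hinner : inner ℝ (outerHerm (s • (x + w))) (outerHerm x) =
      inner ℝ (outerHerm (s • (x + w))) (outerHerm w) := by
    rw [inner_outerHerm, inner_outerHerm, smul_dotProduct, smul_dotProduct, add_dotProduct,
      add_dotProduct, hx, hw, hwx, smul_eq_mul, smul_eq_mul, Complex.normSq_mul,
      Complex.normSq_mul, ← Complex.normSq_conj (1 + _)]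
    simp [add_comm]
  have hne := (inner_lt_one_iff_real_of_norm_eq_one (norm_eq_one_of_mem_pureStates hP)
    (norm_eq_one_of_mem_pureStates hQ)).2 hPQ |>.ne
  refine ⟨_, hR, _, hR', fun h => hne ?_, fun h => hne ?_, hsum⟩
  · rw [h, real_inner_self_eq_norm_sq, norm_eq_one_of_mem_pureStates hP] at hinner
    rw [← hinner, one_pow]
  · rw [h, real_inner_self_eq_norm_sq, norm_eq_one_of_mem_pureStates hQ] at hinner
    rw [real_inner_comm, hinner, one_pow]

end SumOfPureStates

section Hamming

variable {ι : Type*} {V : ι → Type*}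

/-- `p` and `q` differ at the coordinate `i` and nowhere else. -/
def DiffersOnlyAt (i : ι) (p q : (i : ι) → V i) : Prop :=
  p i ≠ q i ∧ ∀ j, j ≠ i → p j = q j

theorem DiffersOnlyAt.symm {i : ι} {p q : (i : ι) → V i} (h : DiffersOnlyAt i p q) :
    DiffersOnlyAt i q p :=
  ⟨h.1.symm, fun j hj => (h.2 j hj).symm⟩

theorem DiffersOnlyAt.index_eq {i j : ι} {p q : (i : ι) → V i} (h : DiffersOnlyAt i p q)
    (hj : p j ≠ q j) : j = i :=
  by_contra fun hne => hj (h.2 j hne)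

theorem DiffersOnlyAt.trans {i : ι} {p q r : (i : ι) → V i} (hpq : DiffersOnlyAt i p q)
    (hqr : DiffersOnlyAt i q r) (hne : p ≠ r) : DiffersOnlyAt i p r := by
  have hoff (j : ι) (hj : j ≠ i) : p j = r j := (hpq.2 j hj).trans (hqr.2 j hj)
  refine ⟨fun hi => hne (funext fun j => ?_), hoff⟩
  obtain rfl | hj := eq_or_ne j i
  exacts [hi, hoff j hj]

theorem differsOnlyAt_update [DecidableEq ι] (p : (i : ι) → V i) {i : ι} {x : V i}
    (hx : p i ≠ x) : DiffersOnlyAt i p (Function.update p i x) :=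
  ⟨by simpa using hx, fun _ hj => (Function.update_of_ne hj _ _).symm⟩

theorem exists_differsOnlyAt [∀ i, Nontrivial (V i)] (p : (i : ι) → V i) (i : ι) :
    ∃ q, DiffersOnlyAt i p q := by
  classical
  obtain ⟨x, hx⟩ := exists_ne (p i)
  exact ⟨_, differsOnlyAt_update p hx.symm⟩

variable (V) in
/-- The Hamming graph on a product of sets: two tuples are adjacent when they differ at exactly one
coordinate. -/
def hammingGraph : SimpleGraph ((i : ι) → V i) where
  Adj p q := ∃ i, DiffersOnlyAt i p q
  symm := ⟨fun _ _ ⟨i, h⟩ => ⟨i, h.symm⟩⟩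
  loopless := ⟨fun _ ⟨_, h⟩ => h.1 rfl⟩

theorem DiffersOnlyAt.adj {i : ι} {p q : (i : ι) → V i} (h : DiffersOnlyAt i p q) :
    (hammingGraph V).Adj p q :=
  ⟨i, h⟩

theorem not_hammingGraph_adj_of_ne {i j : ι} (hij : i ≠ j) {p q : (i : ι) → V i} (hi : p i ≠ q i)
    (hj : p j ≠ q j) : ¬ (hammingGraph V).Adj p q :=
  fun ⟨_, h⟩ => hij ((h.index_eq hi).trans (h.index_eq hj).symm)

theorem DiffersOnlyAt.index_eq_of_adj {i j : ι} {p q r : (i : ι) → V i}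
    (hpq : DiffersOnlyAt i p q) (hpr : DiffersOnlyAt j p r) (hqr : (hammingGraph V).Adj q r) :
    i = j := by
  by_contra hij
  refine not_hammingGraph_adj_of_ne hij ?_ ?_ hqr
  · rw [← hpr.2 i hij]
    exact hpq.1.symm
  · rw [← hpq.2 j (Ne.symm hij)]
    exact hpr.1

theorem DiffersOnlyAt.of_induced_square {i : ι} {a b c d : (i : ι) → V i}
    (hab : DiffersOnlyAt i a b) (hbc : (hammingGraph V).Adj b c) (hdc : (hammingGraph V).Adj d c)
    (had : (hammingGraph V).Adj a d) (hac : ¬ (hammingGraph V).Adj a c) (hac' : a ≠ c)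
    (hbd : ¬ (hammingGraph V).Adj b d) (hbd' : b ≠ d) : DiffersOnlyAt i d c := by
  obtain ⟨m, hm⟩ := hbc
  obtain ⟨l, hl⟩ := hdc
  obtain ⟨j, hj⟩ := had
  have hij : i ≠ j := by
    rintro rfl
    exact hbd (hab.symm.trans hj hbd').adj
  have him : i ≠ m := by
    rintro rfl
    exact hac (hab.trans hm hac').adj
  obtain rfl : i = l := hl.index_eq <| by
    rw [← hj.2 i hij, ← hm.2 i him]
    exact hab.1
  exact hl

theorem DiffersOnlyAt.exists_square {i l : ι} (hil : i ≠ l) {p q r : (i : ι) → V i}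
    (hpq : DiffersOnlyAt i p q) (hpr : DiffersOnlyAt l p r) :
    ∃ s, DiffersOnlyAt i r s ∧ DiffersOnlyAt l q s := by
  classical
  refine ⟨Function.update q l (r l), ⟨?_, fun m hm => ?_⟩, differsOnlyAt_update q ?_⟩
  · rw [Function.update_of_ne hil, ← hpr.2 i hil]
    exact hpq.1
  · obtain rfl | hml := eq_or_ne m l
    · rw [Function.update_self]
    · rw [Function.update_of_ne hml, ← hpr.2 m hml, hpq.2 m hm]
  · rw [← hpq.2 l hil.symm]
    exact hpr.1

theorem forall_of_update [Finite ι] [DecidableEq ι] (T : ((i : ι) → V i) → Prop)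
    (p₀ : (i : ι) → V i) (h₀ : T p₀) (h : ∀ p i x, T p → T (Function.update p i x))
    (p : (i : ι) → V i) : T p := by
  have := Fintype.ofFinite ι
  have key (s : Finset ι) : T (s.piecewise p p₀) := by
    induction s using Finset.induction_on with
    | empty => simpa using h₀
    | insert i s _ ih =>
      rw [Finset.piecewise_insert]
      exact h _ _ _ ih
  simpa using key Finset.univ

variable {κ : Type*} {W : κ → Type*}

theorem apply_eq_of_forall_differsOnlyAt [Finite ι] {f : ((i : ι) → V i) → (j : κ) → W j}
    {σ : ι → κ} (hσ : Function.Injective σ)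
    (hf : ∀ i p q, DiffersOnlyAt i p q → DiffersOnlyAt (σ i) (f p) (f q)) {i : ι}
    {p q : (i : ι) → V i} (hpq : p i = q i) : f p (σ i) = f q (σ i) := by
  classical
  suffices h : ∀ r, f (Function.update r i (p i)) (σ i) = f q (σ i) by
    simpa using h p
  refine forall_of_update _ q (by rw [hpq, Function.update_eq_self]) fun r l x hr => ?_
  obtain rfl | hl := eq_or_ne l i
  · rwa [Function.update_idem]
  rw [Function.update_comm hl, ← hr]
  set r' := Function.update r i (p i)
  obtain hx | hx := eq_or_ne (r' l) x
  · rw [← hx, Function.update_eq_self]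
  · exact ((hf l _ _ (differsOnlyAt_update r' hx)).2 _ (hσ.ne hl.symm)).symm

variable (g : hammingGraph V ≃g hammingGraph W)

theorem DiffersOnlyAt.iso_apply_of_common_left {i : ι} {j : κ} {p q r : (i : ι) → V i}
    (hpq : DiffersOnlyAt i p q) (hgpq : DiffersOnlyAt j (g p) (g q)) (hpr : DiffersOnlyAt i p r) :
    DiffersOnlyAt j (g p) (g r) := by
  obtain rfl | hqr := eq_or_ne q r
  · exact hgpq
  · obtain ⟨l, hl⟩ := g.map_adj_iff.2 hpr.adj
    obtain rfl := hgpq.index_eq_of_adj hl (g.map_adj_iff.2 (hpq.symm.trans hpr hqr).adj)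
    exact hl

theorem DiffersOnlyAt.exists_iso_apply_of_parallel {i l : ι} (hil : i ≠ l) {j : κ}
    {p q r : (i : ι) → V i} (hpq : DiffersOnlyAt i p q) (hgpq : DiffersOnlyAt j (g p) (g q))
    (hpr : DiffersOnlyAt l p r) : ∃ s, DiffersOnlyAt i r s ∧ DiffersOnlyAt j (g r) (g s) := by
  obtain ⟨s, hrs, hqs⟩ := hpq.exists_square hil hpr
  have hpsi : p i ≠ s i := by
    rw [← hqs.2 i hil]
    exact hpq.1
  have hpsl : p l ≠ s l := by
    rw [hpq.2 l hil.symm]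
    exact hqs.1
  have hqri : q i ≠ r i := by
    rw [← hpr.2 i hil]
    exact hpq.1.symm
  have hqrl : q l ≠ r l := by
    rw [← hpq.2 l hil.symm]
    exact hpr.1
  exact ⟨s, hrs, hgpq.of_induced_square (g.map_adj_iff.2 hqs.adj) (g.map_adj_iff.2 hrs.adj)
    (g.map_adj_iff.2 hpr.adj)
    (mt g.map_adj_iff.1 (not_hammingGraph_adj_of_ne hil hpsi hpsl))
    (g.injective.ne fun h => hpsi (congrFun h i))
    (mt g.map_adj_iff.1 (not_hammingGraph_adj_of_ne hil hqri hqrl))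
    (g.injective.ne fun h => hqri (congrFun h i))⟩

variable [Finite ι] [∀ i, Nontrivial (V i)]

theorem exists_direction_of_hammingGraph_iso (i : ι) :
    ∃ j, ∀ p q, DiffersOnlyAt i p q → DiffersOnlyAt j (g p) (g q) := by
  classical
  let p₀ : (i : ι) → V i := fun _ => Classical.arbitrary _
  obtain ⟨q₀, hq₀⟩ := exists_differsOnlyAt p₀ i
  obtain ⟨j, hj⟩ := g.map_adj_iff.2 hq₀.adj
  refine ⟨j, forall_of_update _ p₀ (fun q => hq₀.iso_apply_of_common_left g hj) ?_⟩
  intro p l x hp q hq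
  obtain hx | hx := eq_or_ne (p l) x
  · rw [← hx, Function.update_eq_self] at hq ⊢
    exact hp q hq
  have hpl := differsOnlyAt_update p hx
  obtain rfl | hil := eq_or_ne i l
  · exact hpl.symm.iso_apply_of_common_left g (hp _ hpl).symm hq
  · obtain ⟨r, hr⟩ := exists_differsOnlyAt p i
    obtain ⟨s, hs, hgs⟩ := hr.exists_iso_apply_of_parallel g hil (hp r hr) hpl
    exact hs.iso_apply_of_common_left g hgs hq

theorem exists_equiv_of_hammingGraph_iso [Finite κ] [∀ j, Nontrivial (W j)] :
    ∃ (π : κ ≃ ι) (φ : (j : κ) → V (π j) → W j), (∀ j, Function.Injective (φ j)) ∧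
      ∀ p j, g p j = φ j (p (π j)) := by
  classical
  choose σ hσ using exists_direction_of_hammingGraph_iso g
  choose τ hτ using exists_direction_of_hammingGraph_iso g.symm
  let p₀ : (i : ι) → V i := fun _ => Classical.arbitrary _
  have hτσ (i : ι) : τ (σ i) = i := by
    obtain ⟨q, hq⟩ := exists_differsOnlyAt p₀ i
    have := hτ _ _ _ (hσ i _ _ hq)
    rw [g.symm_apply_apply, g.symm_apply_apply] at this
    exact hq.index_eq this.1
  have hστ (j : κ) : σ (τ j) = j := by
    obtain ⟨q, hq⟩ := exists_differsOnlyAt (g p₀) j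
    have := hσ _ _ _ (hτ j _ _ hq)
    rw [g.apply_symm_apply, g.apply_symm_apply] at this
    exact hq.index_eq this.1
  refine ⟨⟨τ, σ, hστ, hτσ⟩, fun j x => g (Function.update p₀ (τ j) x) j, fun j x y hxy => ?_,
    fun p j => ?_⟩
  · by_contra hne
    have hupd := differsOnlyAt_update (Function.update p₀ (τ j) x) (i := τ j) (x := y) (by simpa)
    rw [Function.update_idem] at hupd
    exact (hστ j ▸ hσ _ _ _ hupd).1 hxy
  · have h := apply_eq_of_forall_differsOnlyAt (f := g) (Function.LeftInverse.injective hτσ) hσ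
      (p := p) (q := Function.update p₀ (τ j) (p (τ j))) (Function.update_self _ _ _).symm
    rwa [hστ] at h

end Hamming

section ProductStates

open scoped Matrix.Norms.Frobenius

variable {k : ℕ} {n : Fin k → ℕ}

variable (n) in
/-- The partial trace over all tensor factors but the `j`-th, defined as the adjoint of
`X ↦ 1 ⊗ ⋯ ⊗ X ⊗ ⋯ ⊗ 1`. -/
noncomputable def partialTrace (j : Fin k) : Herm (ProdIdx n) →ₗ[ℝ] Herm (Fin (n j)) :=
  LinearMap.adjoint ((tensorHermMap n).toLinearMap 1 j)

theorem inner_tensorHerm_update_one {P : (i : Fin k) → Herm (Fin (n i))} {j : Fin k}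
    (hP : ∀ i ≠ j, inner ℝ (P i) 1 = (1 : ℝ)) (X : Herm (Fin (n j))) :
    inner ℝ (tensorHerm P) (tensorHerm (Function.update 1 j X)) = inner ℝ (P j) X := by
  rw [inner_tensorHerm, Fintype.prod_eq_single j fun i hi => ?_, Function.update_self]
  rw [Function.update_of_ne hi, Pi.one_apply, hP i hi]

theorem inner_tensorHerm_update_update_one {P : (i : Fin k) → Herm (Fin (n i))} {i j : Fin k}
    (hij : i ≠ j) (hP : ∀ l, inner ℝ (P l) 1 = (1 : ℝ)) (X : Herm (Fin (n i)))
    (Y : Herm (Fin (n j))) :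
    inner ℝ (tensorHerm P) (tensorHerm (Function.update (Function.update 1 j Y) i X)) =
      inner ℝ (P i) X * inner ℝ (P j) Y := by
  rw [inner_tensorHerm, Fintype.prod_eq_mul i j hij fun l hl => ?_, Function.update_self,
    Function.update_of_ne hij.symm, Function.update_self]
  rw [Function.update_of_ne hl.1, Function.update_of_ne hl.2, Pi.one_apply, hP l]

theorem partialTrace_tensorHerm {P : (i : Fin k) → Herm (Fin (n i))} {j : Fin k}
    (hP : ∀ i ≠ j, inner ℝ (P i) 1 = (1 : ℝ)) : partialTrace n j (tensorHerm P) = P j := by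
  refine ext_inner_right ℝ fun X => ?_
  rw [partialTrace, LinearMap.adjoint_inner_left, MultilinearMap.toLinearMap_apply,
    tensorHermMap_apply, inner_tensorHerm_update_one hP]

/-- The product pure state of a family of pure states. -/
def productState (p : (i : Fin k) → pureStates (Fin (n i))) : Herm (ProdIdx n) :=
  tensorHerm fun i => (p i : Herm (Fin (n i)))

theorem range_productState : Set.range (productState (n := n)) = productPureStates n := by
  ext T
  constructor
  · rintro ⟨p, rfl⟩
    exact ⟨_, fun i => (p i).2, rfl⟩
  · rintro ⟨P, hP, rfl⟩
    exact ⟨fun i => ⟨P i, hP i⟩, rfl⟩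

theorem partialTrace_productState (p : (i : Fin k) → pureStates (Fin (n i))) (j : Fin k) :
    partialTrace n j (productState p) = p j :=
  partialTrace_tensorHerm fun i _ => inner_one_of_mem_pureStates (p i).2

theorem productState_injective : Function.Injective (productState (n := n)) := fun p q h =>
  funext fun i => Subtype.ext <| by
    rw [← partialTrace_productState, h, partialTrace_productState]

theorem coe_add_coe_of_productState_add {p q r s : (i : Fin k) → pureStates (Fin (n i))}
    (h : productState p + productState q = productState r + productState s) (i : Fin k) :
    (p i + q i : Herm (Fin (n i))) = r i + s i := by
  simpa only [map_add, partialTrace_productState] using congrArg (partialTrace n i) h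

theorem apply_eq_of_productState_add {p q r s : (i : Fin k) → pureStates (Fin (n i))}
    (h : productState p + productState q = productState r + productState s) {i : Fin k}
    (hi : p i = q i) : r i = p i := by
  have hsum := coe_add_coe_of_productState_add h i
  rw [← hi] at hsum
  exact Subtype.ext <| eq_of_add_self_eq_add (norm_eq_one_of_mem_pureStates (p i).2)
    (norm_eq_one_of_mem_pureStates (r i).2) (norm_eq_one_of_mem_pureStates (s i).2) hsum

theorem apply_eq_and_apply_eq_of_productState_add
    {p q r s : (i : Fin k) → pureStates (Fin (n i))}
    (h : productState p + productState q = productState r + productState s) {i j : Fin k}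
    (hij : i ≠ j) (hi : p i ≠ q i) (hj : p j ≠ q j) :
    (r i = p i ∧ r j = p j) ∨ (r i = q i ∧ r j = q j) := by
  have hnorm (t : (i : Fin k) → pureStates (Fin (n i))) (l : Fin k) :
      ‖(t l : Herm (Fin (n l)))‖ = 1 := norm_eq_one_of_mem_pureStates (t l).2
  refine Or.imp (And.imp Subtype.ext Subtype.ext) (And.imp Subtype.ext Subtype.ext) <|
    eq_or_eq_of_forall_add_inner_mul_inner (hnorm p i) (hnorm q i) (hnorm r i) (hnorm s i)
    (Subtype.coe_injective.ne hi) (Subtype.coe_injective.ne hj)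
    (coe_add_coe_of_productState_add h i) (coe_add_coe_of_productState_add h j) fun X Y => ?_
  have hinner (t : (i : Fin k) → pureStates (Fin (n i))) :
      inner ℝ (productState t) (tensorHerm (Function.update (Function.update 1 j Y) i X)) =
        inner ℝ (t i : Herm (Fin (n i))) X * inner ℝ (t j : Herm (Fin (n j))) Y :=
    inner_tensorHerm_update_update_one hij (fun l => inner_one_of_mem_pureStates (t l).2) X Y
  simp only [← hinner, ← inner_add_left, h]

theorem eq_or_eq_of_productState_add {p q r s : (i : Fin k) → pureStates (Fin (n i))}
    (h : productState p + productState q = productState r + productState s) {i j : Fin k}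
    (hij : i ≠ j) (hi : p i ≠ q i) (hj : p j ≠ q j) : r = p ∨ r = q := by
  have hagree {l : Fin k} (hl : p l = q l) : r l = p l := apply_eq_of_productState_add h hl
  have hpair {l : Fin k} (hl : i ≠ l) (hne : p l ≠ q l) :=
    apply_eq_and_apply_eq_of_productState_add h hl hi hne
  refine (apply_eq_and_apply_eq_of_productState_add h hij hi hj).imp (fun hri => ?_) fun hri => ?_
  all_goals
    funext l
    grind

end ProductStates

section SumsAgain

/-- `x` and `y` are distinct, and `x + y` is also a sum of two elements of `S` the first of which
is neither `x` nor `y`. -/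
def SumsAgain {E : Type*} [Add E] (S : Set E) (x y : E) : Prop :=
  x ≠ y ∧ ∃ r ∈ S, ∃ s ∈ S, r ≠ x ∧ r ≠ y ∧ x + y = r + s

theorem sumsAgain_image_iff {E F G : Type*} [Add E] [Add F] [FunLike G E F] [AddHomClass G E F]
    {S : Set E} {f : G} (hf : Function.Injective f) {x y : E} :
    SumsAgain (f '' S) (f x) (f y) ↔ SumsAgain S x y := by
  simp only [SumsAgain, Set.exists_mem_image, ← map_add, hf.ne_iff, hf.eq_iff]

variable {k : ℕ} {n : Fin k → ℕ} {p q : (i : Fin k) → pureStates (Fin (n i))}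

theorem hammingGraph_adj_of_sumsAgain
    (h : SumsAgain (productPureStates n) (productState p) (productState q)) :
    (hammingGraph fun i => pureStates (Fin (n i))).Adj p q := by
  rw [← range_productState] at h
  obtain ⟨hne, _, ⟨r, rfl⟩, _, ⟨s, rfl⟩, hrp, hrq, hsum⟩ := h
  obtain ⟨i, hi⟩ := Function.ne_iff.1 (ne_of_apply_ne productState hne)
  refine ⟨i, hi, fun j hj => ?_⟩
  by_contra hpq
  obtain h | h := eq_or_eq_of_productState_add hsum hj.symm hi hpq
  exacts [hrp (congrArg productState h), hrq (congrArg productState h)]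

theorem productState_update (p : (i : Fin k) → pureStates (Fin (n i))) (i : Fin k)
    (X : pureStates (Fin (n i))) :
    productState (Function.update p i X) =
      (tensorHermMap n).toLinearMap (fun l => (p l : Herm (Fin (n l)))) i X := by
  rw [MultilinearMap.toLinearMap_apply, tensorHermMap_apply, productState]
  congr with l : 1
  exact Function.apply_update (fun _ => Subtype.val) p i X l

theorem sumsAgain_of_hammingGraph_adj
    (h : (hammingGraph fun i => pureStates (Fin (n i))).Adj p q) :
    SumsAgain (productPureStates n) (productState p) (productState q) := by
  obtain ⟨i, hi, hq⟩ := h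
  obtain ⟨R, hR, S, hS, hRp, hRq, hsum⟩ :=
    exists_add_eq_add (p i).2 (q i).2 (Subtype.coe_injective.ne hi)
  have hp : productState p = productState (Function.update p i (p i)) := by
    rw [Function.update_eq_self]
  have hq : productState q = productState (Function.update p i (q i)) := by
    exact congrArg productState (Function.eq_update_iff.2 ⟨rfl, fun j hj => (hq j hj).symm⟩)
  have hinj := productState_injective.comp (Function.update_injective p i)
  rw [hp, hq, ← range_productState]
  refine ⟨hinj.ne hi, _, ⟨Function.update p i ⟨R, hR⟩, rfl⟩, _,
    ⟨Function.update p i ⟨S, hS⟩, rfl⟩, hinj.ne (ne_of_apply_ne Subtype.val hRp),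
    hinj.ne (ne_of_apply_ne Subtype.val hRq), ?_⟩
  simp only [productState_update, ← map_add, hsum]

theorem sumsAgain_productState_iff :
    SumsAgain (productPureStates n) (productState p) (productState q) ↔
      (hammingGraph fun i => pureStates (Fin (n i))).Adj p q :=
  ⟨hammingGraph_adj_of_sumsAgain, sumsAgain_of_hammingGraph_adj⟩

end SumsAgain

theorem injective_of_span_eq_top_of_subset_range {K E : Type*} [DivisionRing K] [AddCommGroup E]
    [Module K E] [FiniteDimensional K E] {S : Set E} (hS : Submodule.span K S = ⊤) {f : E →ₗ[K] E}
    (h : S ⊆ Set.range f) : Function.Injective f := by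
  rwa [LinearMap.injective_iff_surjective, ← LinearMap.range_eq_top, eq_top_iff, ← hS,
    Submodule.span_le]

theorem nontrivial_pureStates {ι : Type} [Fintype ι] [DecidableEq ι] [Nontrivial ι] :
    Nontrivial (pureStates ι) := by
  obtain ⟨i, j, hij⟩ := exists_pair_ne ι
  have hmem (l : ι) : outerHerm (Pi.single l (1 : ℂ)) ∈ pureStates ι :=
    outerHerm_mem_pureStates (by simp)
  refine ⟨⟨_, hmem i⟩, ⟨_, hmem j⟩, fun h => ?_⟩
  have := congr((($h : Herm ι) : Matrix ι ι ℂ) i i)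
  simp [coe_outerHerm, Matrix.vecMulVec_apply, hij] at this

section ImageProductPureStates

variable {k : ℕ} {n : Fin k → ℕ} {Ψ : Herm (ProdIdx n) →ₗ[ℝ] Herm (ProdIdx n)}

theorem exists_hammingGraph_iso_of_image_productPureStates
    (h : Ψ '' productPureStates n = productPureStates n) :
    ∃ g : (hammingGraph fun i => pureStates (Fin (n i))) ≃g
        (hammingGraph fun i => pureStates (Fin (n i))),
      ∀ p, productState (g p) = Ψ (productState p) := by
  have hinj : Function.Injective Ψ :=
    injective_of_span_eq_top_of_subset_range span_productPureStates
      (h.superset.trans (Set.image_subset_range _ _))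
  have hbij : Set.BijOn Ψ (Set.range productState) (Set.range (productState (n := n))) := by
    rw [range_productState]
    exact ⟨Set.mapsTo_iff_image_subset.2 h.subset, hinj.injOn, h.superset⟩
  let e := Equiv.ofInjective (productState (n := n)) productState_injective
  let g := (e.trans (hbij.equiv Ψ)).trans e.symm
  have hg (p) : productState (g p) = Ψ (productState p) :=
    Equiv.apply_ofInjective_symm productState_injective _
  refine ⟨⟨g, fun {p q} => ?_⟩, hg⟩
  rw [← sumsAgain_productState_iff, ← sumsAgain_productState_iff, hg, hg,
    ← sumsAgain_image_iff hinj (x := productState p), h]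

theorem exists_perm_of_image_productPureStates (hn : ∀ i, 2 ≤ n i)
    (h : Ψ '' productPureStates n = productPureStates n) :
    ∃ (π : Equiv.Perm (Fin k)) (φ : (i : Fin k) → pureStates (Fin (n (π i))) →
      pureStates (Fin (n i))), (∀ i, Function.Injective (φ i)) ∧
      ∀ p, Ψ (productState p) = productState fun i => φ i (p (π i)) := by
  obtain ⟨g, hg⟩ := exists_hammingGraph_iso_of_image_productPureStates h
  have (i : Fin k) : Nontrivial (pureStates (Fin (n i))) :=
    have := Fin.nontrivial_iff_two_le.2 (hn i)
    nontrivial_pureStates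
  obtain ⟨π, φ, hφ, hgφ⟩ := exists_equiv_of_hammingGraph_iso g
  exact ⟨π, φ, hφ, fun p => by rw [← hg, funext (hgφ p)]⟩

end ImageProductPureStates

section ExtremePoints

open scoped Matrix.Norms.Frobenius

theorem extremePoints_convexHull_of_subset_sphere {E : Type*} [NormedAddCommGroup E]
    [NormedSpace ℝ E] [StrictConvexSpace ℝ E] {S : Set E} {a : E} {r : ℝ} (hr : r ≠ 0)
    (hS : S ⊆ Metric.sphere a r) : (convexHull ℝ S).extremePoints ℝ = S := by
  refine extremePoints_convexHull_subset.antisymm fun x hx => ?_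
  have hball : convexHull ℝ S ⊆ Metric.closedBall a r :=
    convexHull_min (hS.trans Metric.sphere_subset_closedBall) (convex_closedBall a r)
  exact inter_extremePoints_subset_extremePoints_of_subset hball ⟨subset_convexHull ℝ S hx,
    StrictConvexSpace.sphere_subset_extremePoints_closedBall a hr (hS hx)⟩

variable {k : ℕ} {n : Fin k → ℕ}

theorem norm_productState (p : (i : Fin k) → pureStates (Fin (n i))) : ‖productState p‖ = 1 := by
  rw [← sq_eq_sq₀ (norm_nonneg _) zero_le_one, ← real_inner_self_eq_norm_sq, productState,
    inner_tensorHerm, one_pow]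
  exact Finset.prod_eq_one fun i _ => by
    rw [real_inner_self_eq_norm_sq, norm_eq_one_of_mem_pureStates (p i).2, one_pow]

theorem extremePoints_separableStates :
    (separableStates n).extremePoints ℝ = productPureStates n := by
  refine extremePoints_convexHull_of_subset_sphere (a := 0) one_ne_zero ?_
  rw [← range_productState]
  rintro _ ⟨p, rfl⟩
  exact mem_sphere_zero_iff_norm.2 (norm_productState p)

theorem image_separableStates_eq_iff {Ψ : Herm (ProdIdx n) →ₗ[ℝ] Herm (ProdIdx n)} :
    Ψ '' separableStates n = separableStates n ↔
      Ψ '' productPureStates n = productPureStates n := by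
  refine ⟨fun h => ?_, fun h => by rw [separableStates, LinearMap.image_convexHull, h]⟩
  have hinj : Function.Injective Ψ :=
    injective_of_span_eq_top_of_subset_range span_productPureStates <|
      (subset_convexHull ℝ _).trans (h.superset.trans (Set.image_subset_range _ _))
  have himage :=
    image_extremePoints (𝕜 := ℝ) (LinearEquiv.ofInjectiveEndo Ψ hinj) (separableStates n)
  rwa [LinearEquiv.coe_ofInjectiveEndo, h, extremePoints_separableStates] at himage

end ExtremePoints

section MixedMinors

/-- The polarization of the quadratic map sending a matrix to the family of its `2 × 2` minors:
`mixedMinors M M p r q s` is twice the minor of `M` with rows `p, r` and columns `q, s`. -/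
def mixedMinors {R m n : Type*} [CommRing R] :
    Matrix m n R →ₗ[R] Matrix m n R →ₗ[R] m → m → n → n → R :=
  LinearMap.mk₂ R
    (fun M N p r q s => M p q * N r s + N p q * M r s - M p s * N r q - N p s * M r q)
    (fun _ _ _ => by ext; simp only [Matrix.add_apply, Pi.add_apply]; ring)
    (fun _ _ _ => by ext; simp only [Matrix.smul_apply, Pi.smul_apply, smul_eq_mul]; ring)
    (fun _ _ _ => by ext; simp only [Matrix.add_apply, Pi.add_apply]; ring)
    (fun _ _ _ => by ext; simp only [Matrix.smul_apply, Pi.smul_apply, smul_eq_mul]; ring)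

/-- The exterior product of two vectors, as the family of its coordinates. -/
def wedge {R m : Type*} [CommRing R] (a c : m → R) (p r : m) : R :=
  a p * c r - c p * a r

section CommRing

variable {R m n : Type*} [CommRing R]

theorem mixedMinors_apply (M N : Matrix m n R) (p r : m) (q s : n) :
    mixedMinors M N p r q s = M p q * N r s + N p q * M r s - M p s * N r q - N p s * M r q := rfl

theorem mixedMinors_comm (M N : Matrix m n R) : mixedMinors M N = mixedMinors N M := by
  ext
  simp only [mixedMinors_apply]
  ring

theorem mixedMinors_vecMulVec (a c : m → R) (b d : n → R) (p r : m) (q s : n) :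
    mixedMinors (Matrix.vecMulVec a b) (Matrix.vecMulVec c d) p r q s =
      wedge a c p r * wedge b d q s := by
  simp only [mixedMinors_apply, wedge, Matrix.vecMulVec_apply]
  ring

theorem wedge_self (a : m → R) : wedge a a = 0 := by
  ext
  simp only [wedge, sub_self, Pi.zero_apply]

theorem wedge_smul_left (t : R) (a c : m → R) : wedge (t • a) c = t • wedge a c := by
  ext
  simp only [wedge, Pi.smul_apply, smul_eq_mul]
  ring

theorem wedge_comm (a c : m → R) : wedge a c = -wedge c a := by
  ext
  simp only [wedge, Pi.neg_apply]
  ring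

theorem wedge_star [StarRing R] (a c : m → R) : wedge (star a) (star c) = star (wedge a c) := by
  ext
  simp only [wedge, Pi.star_apply, star_sub, star_mul']

theorem mixedMinors_vecMulVec_self (a : m → R) (b : n → R) :
    mixedMinors (Matrix.vecMulVec a b) (Matrix.vecMulVec a b) = 0 := by
  ext
  simp only [mixedMinors_vecMulVec, wedge_self, Pi.zero_apply, zero_mul]

end CommRing

section Field

variable {K m n : Type*} [Field K]

theorem exists_eq_smul_of_wedge_eq_zero {a c : m → K} (hc : c ≠ 0) (h : wedge a c = 0) :
    ∃ t : K, a = t • c := by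
  obtain ⟨r, hr⟩ := Function.ne_iff.1 hc
  refine ⟨a r / c r, funext fun p => ?_⟩
  rw [Pi.smul_apply, smul_eq_mul, div_mul_eq_mul_div, eq_div_iff hr]
  exact (sub_eq_zero.1 congr($h p r)).trans (mul_comm _ _)

theorem wedge_eq_zero_or_of_mixedMinors_eq_zero {a c : m → K} {b d : n → K}
    (h : mixedMinors (Matrix.vecMulVec a b) (Matrix.vecMulVec c d) = 0) :
    wedge a c = 0 ∨ wedge b d = 0 := by
  by_contra! ⟨hac, hbd⟩
  obtain ⟨p, hp⟩ := Function.ne_iff.1 hac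
  obtain ⟨r, hr⟩ := Function.ne_iff.1 hp
  obtain ⟨q, hq⟩ := Function.ne_iff.1 hbd
  obtain ⟨s, hs⟩ := Function.ne_iff.1 hq
  exact mul_ne_zero hr hs (by rw [← mixedMinors_vecMulVec, h]; rfl)

theorem exists_eq_vecMulVec_of_mixedMinors_self_eq_zero [NeZero (2 : K)] {M : Matrix m n K}
    (h : mixedMinors M M = 0) : ∃ a b, M = Matrix.vecMulVec a b := by
  by_cases hM : ∀ r s, M r s = 0
  · exact ⟨0, 0, Matrix.ext fun r s => by rw [hM, Matrix.zero_vecMulVec, Matrix.zero_apply]⟩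
  push Not at hM
  obtain ⟨r, s, hrs⟩ := hM
  refine ⟨fun p => M p s / M r s, M r, Matrix.ext fun p q => ?_⟩
  rw [Matrix.vecMulVec_apply, div_mul_eq_mul_div, eq_div_iff hrs]
  refine mul_left_cancel₀ (two_ne_zero (α := K)) ?_
  have hminor : mixedMinors M M p r q s = 0 := congr($h p r q s)
  rw [mixedMinors_apply] at hminor
  linear_combination hminor

end Field

end MixedMinors

section Polarization

section Bilinear

variable {K V W M N : Type*} [Field K] [NeZero (2 : K)] [AddCommGroup V] [Module K V]
  [AddCommGroup W] [Module K W] [AddCommGroup M] [Module K M] [AddCommGroup N] [Module K N]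
  {D : M →ₗ[K] M →ₗ[K] N} {f : V →ₗ[K] W →ₗ[K] M}

theorem eq_zero_of_forall_self_eq_zero (hD : ∀ a b, D a b = D b a)
    (hf : ∀ v w, D (f v w) (f v w) = 0) (v v' : V) (w : W) : D (f v w) (f v' w) = 0 := by
  have hadd := hf (v + v') w
  simp only [map_add, LinearMap.add_apply, hf, hD (f v' w) (f v w)] at hadd
  rw [zero_add, add_zero, ← two_smul K] at hadd
  exact (smul_eq_zero_iff_right two_ne_zero).1 hadd

theorem add_eq_zero_of_forall_self_eq_zero (hD : ∀ a b, D a b = D b a)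
    (hf : ∀ v w, D (f v w) (f v w) = 0) (v v' : V) (w w' : W) :
    D (f v w) (f v' w') + D (f v w') (f v' w) = 0 := by
  simpa [eq_zero_of_forall_self_eq_zero hD hf] using
    eq_zero_of_forall_self_eq_zero hD hf v v' (w + w')

end Bilinear

open scoped ComplexConjugate in
/-- A polynomial in `z` and `conj z` vanishing on `ℂ` has zero coefficients; the coefficient of
`z ^ 2` is extracted by evaluating at the fourth roots of unity and at their multiples by
`1 + I`. -/
theorem self_eq_zero_of_forall_pencil {V W : Type*} [AddCommGroup V] [Module ℂ V] [AddCommGroup W]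
    [Module ℂ W] {D : V →ₗ[ℂ] V →ₗ[ℂ] W} {A B C E : V}
    (h : ∀ z : ℂ, D (A + conj z • B + z • C + (z * conj z) • E)
      (A + conj z • B + z • C + (z * conj z) • E) = 0) : D C C = 0 := by
  have hsum (w : ℂ) : conj w ^ 2 • D B B + w ^ 2 • D C C = 0 := by
    have h₁ := h w
    have h₂ := h (-w)
    have h₃ := h (Complex.I * w)
    have h₄ := h (-(Complex.I * w))
    simp only [map_add, map_smul, map_neg, map_mul, Complex.conj_I, LinearMap.add_apply,
      LinearMap.smul_apply] at h₁ h₂ h₃ h₄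
    linear_combination (norm := skip) (4⁻¹ : ℂ) • (h₁ + h₂ - h₃ - h₄)
    match_scalars <;> grind [Complex.I_sq]
  have hconj : conj (1 + Complex.I) ^ 2 = -(2 * Complex.I) := by
    simp only [map_add, map_one, Complex.conj_I]
    linear_combination Complex.I_sq
  have hsq : (1 + Complex.I) ^ 2 = 2 * Complex.I := by linear_combination Complex.I_sq
  have h₁ := hsum 1
  have h₂ := hsum (1 + Complex.I)
  rw [map_one, one_pow] at h₁
  rw [hconj, hsq] at h₂
  linear_combination (norm := skip) (2⁻¹ : ℂ) • h₁ - (Complex.I / 4) • h₂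
  match_scalars <;> grind [Complex.I_sq]

end Polarization

section Complexification

open scoped ComplexConjugate

variable {E F : Type*} [AddCommGroup E] [Module ℂ E] [StarAddMonoid E] [StarModule ℂ E]
  [AddCommGroup F] [Module ℂ F] [StarAddMonoid F] [StarModule ℂ F]

/-- The complex-linear extension of a real-linear map between the self-adjoint parts of complex
star modules. -/
noncomputable def complexify (ψ : selfAdjoint E →ₗ[ℝ] selfAdjoint F) : E →ₗ[ℂ] F where
  toFun X := (ψ (realPart X) : F) + Complex.I • (ψ (imaginaryPart X) : F)
  map_add' X Y := by
    simp only [map_add, AddSubgroup.coe_add, smul_add]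
    abel
  map_smul' z X := by
    simp only [realPart_smul, imaginaryPart_smul, map_add, map_sub, map_smul, AddSubgroup.coe_add,
      AddSubgroup.coe_sub, selfAdjoint.val_smul, RingHom.id_apply, ← Complex.coe_smul]
    match_scalars <;> grind [Complex.I_sq, Complex.re_add_im z]

theorem complexify_coe (ψ : selfAdjoint E →ₗ[ℝ] selfAdjoint F) (A : selfAdjoint E) :
    complexify ψ (A : E) = ψ A := by
  change (ψ (realPart (A : E)) : F) + Complex.I • (ψ (imaginaryPart (A : E)) : F) = ψ A
  rw [selfAdjoint.realPart_coe, selfAdjoint.imaginaryPart_coe, map_zero, ZeroMemClass.coe_zero,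
    smul_zero, add_zero]

theorem complexify_star (ψ : selfAdjoint E →ₗ[ℝ] selfAdjoint F) (X : E) :
    complexify ψ (star X) = star (complexify ψ X) := by
  rw [← realPart_add_I_smul_imaginaryPart X]
  simp only [star_add, star_smul, selfAdjoint.star_val_eq, map_add, map_smul, complexify_coe]

end Complexification

section Isometry

open scoped ComplexConjugate Matrix.Norms.Frobenius

variable {ι κ : Type} [Fintype ι] [DecidableEq ι] [Fintype κ] [DecidableEq κ]
  {ψ : Herm ι →ₗ[ℝ] Herm κ}

omit [DecidableEq ι] in
theorem exists_eq_smul_of_ne_zero {x : ι → ℂ} (hx : x ≠ 0) :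
    ∃ (c : ℂ) (y : ι → ℂ), y ⬝ᵥ star y = 1 ∧ x = c • y := by
  set s : ℂ := (‖WithLp.toLp 2 x‖ : ℂ) with hs
  have hs0 : s ≠ 0 := by simpa [hs] using hx
  have hxx : x ⬝ᵥ star x = s ^ 2 :=
    (EuclideanSpace.inner_eq_star_dotProduct _ _).symm.trans (inner_self_eq_norm_sq_to_K _)
  refine ⟨s, s⁻¹ • x, ?_, (smul_inv_smul₀ hs0 x).symm⟩
  rw [smul_dotProduct_star_smul, hxx, Complex.normSq_eq_norm_sq, norm_inv, hs,
    Complex.norm_real, norm_norm, Complex.ofReal_pow, Complex.ofReal_inv, ← mul_pow,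
    inv_mul_cancel₀ hs0, one_pow]

theorem mixedMinors_map_outerHerm (hψ : Set.MapsTo ψ (pureStates ι) (pureStates κ)) (x : ι → ℂ) :
    mixedMinors (ψ (outerHerm x) : Matrix κ κ ℂ) (ψ (outerHerm x)) = 0 := by
  rcases eq_or_ne x 0 with rfl | hx
  · rw [show outerHerm (0 : ι → ℂ) = 0 from Subtype.ext (Matrix.zero_vecMulVec _), map_zero,
      ZeroMemClass.coe_zero, map_zero]
  obtain ⟨c, y, hy, rfl⟩ := exists_eq_smul_of_ne_zero hx
  obtain ⟨v, -, hv⟩ := mem_pureStates_iff.1 (hψ (outerHerm_mem_pureStates hy))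
  rw [outerHerm_smul, map_smul, hv, ← outerHerm_smul, coe_outerHerm, mixedMinors_vecMulVec_self]

theorem mixedMinors_complexify_vecMulVec_self
    (hψ : Set.MapsTo ψ (pureStates ι) (pureStates κ)) (x y : ι → ℂ) :
    mixedMinors (complexify ψ (Matrix.vecMulVec x y)) (complexify ψ (Matrix.vecMulVec x y)) =
      0 := by
  refine self_eq_zero_of_forall_pencil (A := complexify ψ (Matrix.vecMulVec (star y) y))
    (B := complexify ψ (Matrix.vecMulVec (star y) (star x)))
    (E := complexify ψ (Matrix.vecMulVec x (star x))) fun z => ?_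
  have hminors := mixedMinors_map_outerHerm hψ (star y + z • x)
  rw [← complexify_coe, coe_outerHerm] at hminors
  have hpencil : Matrix.vecMulVec (star y) y + conj z • Matrix.vecMulVec (star y) (star x) +
      z • Matrix.vecMulVec x y + (z * conj z) • Matrix.vecMulVec x (star x) =
        Matrix.vecMulVec (star y + z • x) (star (star y + z • x)) := by
    simp only [star_add, star_star, star_smul, Matrix.add_vecMulVec, Matrix.vecMulVec_add,
      Matrix.smul_vecMulVec, Matrix.vecMulVec_smul, Complex.star_def]
    module
  simpa only [← map_smul, ← map_add, hpencil] using hminors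

theorem mixedMinors_complexify_vecMulVec_left
    (hψ : Set.MapsTo ψ (pureStates ι) (pureStates κ)) (x x' y : ι → ℂ) :
    mixedMinors (complexify ψ (Matrix.vecMulVec x y)) (complexify ψ (Matrix.vecMulVec x' y)) = 0 :=
  eq_zero_of_forall_self_eq_zero mixedMinors_comm
    (f := (vecMulVecBilin ℂ ℂ).compr₂ (complexify ψ))
    (mixedMinors_complexify_vecMulVec_self hψ) x x' y

theorem mixedMinors_complexify_vecMulVec_right
    (hψ : Set.MapsTo ψ (pureStates ι) (pureStates κ)) (x y y' : ι → ℂ) :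
    mixedMinors (complexify ψ (Matrix.vecMulVec x y)) (complexify ψ (Matrix.vecMulVec x y')) = 0 :=
  eq_zero_of_forall_self_eq_zero mixedMinors_comm
    (f := ((vecMulVecBilin ℂ ℂ).compr₂ (complexify ψ)).flip)
    (fun y x => mixedMinors_complexify_vecMulVec_self hψ x y) y y' x

theorem mixedMinors_complexify_add_mixedMinors_complexify
    (hψ : Set.MapsTo ψ (pureStates ι) (pureStates κ)) (x x' y y' : ι → ℂ) :
    mixedMinors (complexify ψ (Matrix.vecMulVec x y)) (complexify ψ (Matrix.vecMulVec x' y')) +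
      mixedMinors (complexify ψ (Matrix.vecMulVec x y')) (complexify ψ (Matrix.vecMulVec x' y)) =
        0 :=
  add_eq_zero_of_forall_self_eq_zero mixedMinors_comm
    (f := (vecMulVecBilin ℂ ℂ).compr₂ (complexify ψ))
    (mixedMinors_complexify_vecMulVec_self hψ) x x' y y'

theorem complexify_vecMulVec_star (ψ : Herm ι →ₗ[ℝ] Herm κ) (x : ι → ℂ) :
    complexify ψ (Matrix.vecMulVec x (star x)) = ψ (outerHerm x) :=
  complexify_coe ψ (outerHerm x)

theorem complexify_conjTranspose (ψ : Herm ι →ₗ[ℝ] Herm κ) (X : Matrix ι ι ℂ) :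
    complexify ψ Xᴴ = (complexify ψ X)ᴴ :=
  complexify_star ψ X

theorem eq_one_of_forall_inner_eq_one {A : Herm ι}
    (h : ∀ P ∈ pureStates ι, inner ℝ A P = (1 : ℝ)) : A = 1 := by
  have heq : innerₛₗ ℝ A = innerₛₗ ℝ (1 : Herm ι) := LinearMap.ext_on span_pureStates fun P hP => by
    rw [innerₛₗ_apply_apply, innerₛₗ_apply_apply, h P hP, real_inner_comm,
      inner_one_of_mem_pureStates hP]
  exact ext_inner_right ℝ fun B => LinearMap.congr_fun heq B

theorem exists_isometry_of_map_outerHerm (hψ : Set.MapsTo ψ (pureStates ι) (pureStates κ))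
    {L : (ι → ℂ) →ₗ[ℂ] κ → ℂ} (hL : ∀ y, y ⬝ᵥ star y = 1 → ψ (outerHerm y) = outerHerm (L y)) :
    ∃ U : Matrix κ ι ℂ, Uᴴ * U = 1 ∧ ∀ X, (ψ X : Matrix κ κ ℂ) = U * (X : Matrix ι ι ℂ) * Uᴴ := by
  set U := LinearMap.toMatrix' L
  have hconj (X : Herm ι) : (ψ X : Matrix κ κ ℂ) = U * (X : Matrix ι ι ℂ) * Uᴴ := by
    induction (span_pureStates (ι := ι) ▸ Submodule.mem_top : X ∈ Submodule.span ℝ (pureStates ι))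
      using Submodule.span_induction with
    | mem P hP =>
      obtain ⟨y, hy, rfl⟩ := mem_pureStates_iff.1 hP
      rw [hL y hy, coe_outerHerm, coe_outerHerm, Matrix.mul_vecMulVec, Matrix.vecMulVec_mul,
        ← Matrix.star_mulVec, LinearMap.toMatrix'_mulVec]
    | zero => simp
    | add X Y _ _ hX hY => simp [hX, hY, Matrix.mul_add, Matrix.add_mul]
    | smul r X _ hX => simp [hX]
  refine ⟨U, congrArg Subtype.val (eq_one_of_forall_inner_eq_one
    (A := ⟨Uᴴ * U, Matrix.isHermitian_conjTranspose_mul_self U⟩) fun P hP => ?_), hconj⟩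
  rw [← Complex.ofReal_inj, coe_inner, Complex.ofReal_one, Matrix.mul_assoc, Matrix.trace_mul_comm,
    ← hconj, (hψ hP).2]

theorem eq_smul_of_outerHerm_eq_outerHerm {x y : ι → ℂ} (hx : x ⬝ᵥ star x = 1)
    (h : outerHerm x = outerHerm y) : x = (star y ⬝ᵥ x) • y := by
  have hmul : Matrix.vecMulVec x (star x) *ᵥ x = Matrix.vecMulVec y (star y) *ᵥ x :=
    congr($(congrArg Subtype.val h) *ᵥ x)
  simpa [Matrix.vecMulVec_mulVec, dotProduct_comm (star x) x, hx] using hmul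

omit [DecidableEq ι] in
theorem normSq_eq_one_of_dotProduct_star_smul {c : ℂ} {x : ι → ℂ} (hx : x ⬝ᵥ star x = 1)
    (hcx : (c • x) ⬝ᵥ star (c • x) = 1) : Complex.normSq c = 1 := by
  rw [smul_dotProduct_star_smul, hx, mul_one] at hcx
  exact Complex.ofReal_eq_one.1 hcx

theorem outerHerm_smul_of_normSq_eq_one {c : ℂ} (hc : Complex.normSq c = 1) (x : ι → ℂ) :
    outerHerm (c • x) = outerHerm x := by
  rw [outerHerm_smul, hc, one_smul]

omit [DecidableEq ι] in
theorem ne_zero_of_dotProduct_star_self_eq_one {x : ι → ℂ} (hx : x ⬝ᵥ star x = 1) : x ≠ 0 := by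
  rintro rfl
  rw [zero_dotProduct] at hx
  exact zero_ne_one hx

section RankOneColumn

variable {o : ι → ℂ} {u : κ → ℂ} {L : (ι → ℂ) →ₗ[ℂ] κ → ℂ}

theorem normSq_eq_one_of_eq_smul (hψ : Set.MapsTo ψ (pureStates ι) (pureStates κ))
    (hou : ψ (outerHerm o) = outerHerm u)
    (hL : ∀ w, complexify ψ (Matrix.vecMulVec w (star o)) = Matrix.vecMulVec (L w) (star u))
    {y : ι → ℂ} {p : κ → ℂ} {c : ℂ} (hyp : ψ (outerHerm y) = outerHerm p) (hpu : wedge p u ≠ 0)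
    (hc : L y = c • p) : Complex.normSq c = 1 := by
  obtain ⟨i, hi⟩ := Function.ne_iff.1 hpu
  obtain ⟨j, hij⟩ := Function.ne_iff.1 hi
  have hoy : complexify ψ (Matrix.vecMulVec o (star y)) = Matrix.vecMulVec u (star (L y)) := by
    rw [← star_star o, ← Matrix.conjTranspose_vecMulVec, complexify_conjTranspose, hL,
      Matrix.conjTranspose_vecMulVec, star_star]
  have hfour := mixedMinors_complexify_add_mixedMinors_complexify hψ y o (star y) (star o)
  rw [complexify_vecMulVec_star, complexify_vecMulVec_star, hou, hyp, coe_outerHerm,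
    coe_outerHerm, hoy, hL, hc] at hfour
  have hentry : wedge p u i j * wedge (star p) (star u) i j +
      wedge (c • p) u i j * wedge (star u) (star (c • p)) i j = 0 := by
    simp only [← mixedMinors_vecMulVec]
    exact congr($hfour i j i j)
  have hstar : wedge (star p) (star u) i j ≠ 0 := by
    rw [wedge_star]
    exact star_ne_zero.2 hij
  rw [star_smul, wedge_comm (star u), wedge_smul_left, wedge_smul_left] at hentry
  simp only [Pi.neg_apply, Pi.smul_apply, smul_eq_mul] at hentry
  rw [← Complex.ofReal_inj, ← Complex.mul_conj, ← sub_eq_zero]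
  refine mul_right_cancel₀ (mul_ne_zero hij hstar) ?_
  rw [starRingEnd_apply, Complex.ofReal_one]
  linear_combination -hentry

theorem map_outerHerm_of_map_vecMulVec_star (hψ : Set.MapsTo ψ (pureStates ι) (pureStates κ))
    (hinj : Set.InjOn ψ (pureStates ι)) (ho : o ⬝ᵥ star o = 1) (hu : u ⬝ᵥ star u = 1)
    (hou : ψ (outerHerm o) = outerHerm u)
    (hL : ∀ w, complexify ψ (Matrix.vecMulVec w (star o)) = Matrix.vecMulVec (L w) (star u))
    {y : ι → ℂ} (hy : y ⬝ᵥ star y = 1) : ψ (outerHerm y) = outerHerm (L y) := by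
  obtain ⟨p, hp, hyp⟩ := mem_pureStates_iff.1 (hψ (outerHerm_mem_pureStates hy))
  by_cases hpu : wedge p u = 0
  · have hLo : L o = u := by
      have hmul : Matrix.vecMulVec (L o) (star u) *ᵥ u = Matrix.vecMulVec u (star u) *ᵥ u := by
        rw [← hL, complexify_vecMulVec_star, hou, coe_outerHerm]
      simpa [Matrix.vecMulVec_mulVec, dotProduct_comm (star u), hu] using hmul
    obtain ⟨t, rfl⟩ :=
      exists_eq_smul_of_wedge_eq_zero (ne_zero_of_dotProduct_star_self_eq_one hu) hpu
    rw [outerHerm_smul_of_normSq_eq_one (normSq_eq_one_of_dotProduct_star_smul hu hp)] at hyp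
    obtain ⟨c, rfl⟩ : ∃ c : ℂ, y = c • o := ⟨_, eq_smul_of_outerHerm_eq_outerHerm hy <|
      hinj (outerHerm_mem_pureStates hy) (outerHerm_mem_pureStates ho) (hyp.trans hou.symm)⟩
    rw [hyp, map_smul, hLo,
      outerHerm_smul_of_normSq_eq_one (normSq_eq_one_of_dotProduct_star_smul ho hy)]
  · have hcol := mixedMinors_complexify_vecMulVec_right hψ y (star y) (star o)
    rw [complexify_vecMulVec_star, hL, hyp, coe_outerHerm] at hcol
    have hne : wedge (star p) (star u) ≠ 0 := by rwa [wedge_star, star_ne_zero]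
    have hpL : wedge (L y) p = 0 := by
      rw [wedge_comm, neg_eq_zero]
      exact (wedge_eq_zero_or_of_mixedMinors_eq_zero hcol).resolve_right hne
    obtain ⟨c, hc⟩ :=
      exists_eq_smul_of_wedge_eq_zero (ne_zero_of_dotProduct_star_self_eq_one hp) hpL
    rw [hyp, hc, outerHerm_smul_of_normSq_eq_one (normSq_eq_one_of_eq_smul hψ hou hL hyp hpu hc)]

theorem exists_isometry_of_forall_exists_eq_vecMulVec_star
    (hψ : Set.MapsTo ψ (pureStates ι) (pureStates κ)) (hinj : Set.InjOn ψ (pureStates ι))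
    (ho : o ⬝ᵥ star o = 1) (hu : u ⬝ᵥ star u = 1) (hou : ψ (outerHerm o) = outerHerm u)
    (h : ∀ w, ∃ a, complexify ψ (Matrix.vecMulVec w (star o)) = Matrix.vecMulVec a (star u)) :
    ∃ U : Matrix κ ι ℂ, Uᴴ * U = 1 ∧ ∀ X, (ψ X : Matrix κ κ ℂ) = U * (X : Matrix ι ι ℂ) * Uᴴ := by
  let L : (ι → ℂ) →ₗ[ℂ] κ → ℂ := (Matrix.mulVecBilin ℂ ℂ).flip u ∘ₗ complexify ψ ∘ₗ
    (vecMulVecBilin ℂ ℂ).flip (star o)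
  refine exists_isometry_of_map_outerHerm hψ (L := L) fun y hy =>
    map_outerHerm_of_map_vecMulVec_star hψ hinj ho hu hou (fun w => ?_) hy
  obtain ⟨a, ha⟩ := h w
  have hLw : L w = a := by
    change complexify ψ (Matrix.vecMulVec w (star o)) *ᵥ u = a
    rw [ha, Matrix.vecMulVec_mulVec, dotProduct_comm, hu, MulOpposite.op_one, one_smul]
  rw [ha, hLw]

theorem forall_exists_eq_vecMulVec_or (hψ : Set.MapsTo ψ (pureStates ι) (pureStates κ))
    (hu : u ⬝ᵥ star u = 1) (hou : ψ (outerHerm o) = outerHerm u) :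
    (∀ w, ∃ a, complexify ψ (Matrix.vecMulVec w (star o)) = Matrix.vecMulVec a (star u)) ∨
      ∀ w, ∃ b, complexify ψ (Matrix.vecMulVec w (star o)) = Matrix.vecMulVec u b := by
  let F : (ι → ℂ) →ₗ[ℂ] Matrix κ κ ℂ := complexify ψ ∘ₗ (vecMulVecBilin ℂ ℂ).flip (star o)
  let S : Submodule ℂ (ι → ℂ) :=
    (LinearMap.range ((vecMulVecBilin ℂ ℂ : (κ → ℂ) →ₗ[ℂ] (κ → ℂ) →ₗ[ℂ] _).flip (star u))).comap F
  let T : Submodule ℂ (ι → ℂ) :=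
    (LinearMap.range ((vecMulVecBilin ℂ ℂ : (κ → ℂ) →ₗ[ℂ] (κ → ℂ) →ₗ[ℂ] _) u)).comap F
  have hu0 : u ≠ 0 := ne_zero_of_dotProduct_star_self_eq_one hu
  have hST (w : ι → ℂ) : w ∈ S ∨ w ∈ T := by
    obtain ⟨a, b, hab⟩ := exists_eq_vecMulVec_of_mixedMinors_self_eq_zero
      (mixedMinors_complexify_vecMulVec_self hψ w (star o))
    have hcol := mixedMinors_complexify_vecMulVec_left hψ w o (star o)
    rw [complexify_vecMulVec_star, hou, coe_outerHerm, hab] at hcol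
    rcases wedge_eq_zero_or_of_mixedMinors_eq_zero hcol with ha | hb
    · obtain ⟨t, rfl⟩ := exists_eq_smul_of_wedge_eq_zero hu0 ha
      exact Or.inr ⟨t • b, by simpa [F] using hab.symm⟩
    · obtain ⟨t, rfl⟩ := exists_eq_smul_of_wedge_eq_zero (star_ne_zero.2 hu0) hb
      exact Or.inl ⟨t • a, by simpa [F] using hab.symm⟩
  have hcover : (⊤ : Submodule ℂ (ι → ℂ)) ≤ S ∨ ⊤ ≤ T :=
    AddSubgroupClass.subset_union.1 fun w _ => hST w
  exact hcover.imp (fun h w => (h (Submodule.mem_top (x := w))).imp fun _ => Eq.symm)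
    fun h w => (h (Submodule.mem_top (x := w))).imp fun _ => Eq.symm

end RankOneColumn

/-- Transposition of Hermitian matrices. -/
noncomputable def transposeHerm : Herm ι →ₗ[ℝ] Herm ι :=
  ((Matrix.transposeLinearEquiv ι ι ℝ ℂ).toLinearMap.restrict
    (p := selfAdjoint.submodule ℝ (Matrix ι ι ℂ)) (q := selfAdjoint.submodule ℝ (Matrix ι ι ℂ))
    fun _ hA => Matrix.IsHermitian.transpose hA)

theorem coe_transposeHerm (A : Herm ι) : (transposeHerm A : Matrix ι ι ℂ) = (A : Matrix ι ι ℂ)ᵀ :=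
  rfl

theorem transposeHerm_transposeHerm (A : Herm ι) : transposeHerm (transposeHerm A) = A := rfl

theorem transposeHerm_outerHerm (x : ι → ℂ) :
    transposeHerm (outerHerm x) = outerHerm (star x) :=
  Subtype.ext <| (Matrix.transpose_vecMulVec _ _).trans <| by rw [coe_outerHerm, star_star]

theorem transposeHerm_mem_pureStates {P : Herm ι} (hP : P ∈ pureStates ι) :
    transposeHerm P ∈ pureStates ι :=
  ⟨(Matrix.rank_transpose _).trans hP.1, (Matrix.trace_transpose _).trans hP.2⟩

theorem complexify_comp_transposeHerm (ψ : Herm ι →ₗ[ℝ] Herm κ) (X : Matrix ι ι ℂ) :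
    complexify (ψ ∘ₗ transposeHerm) X = complexify ψ Xᵀ := by
  rw [← realPart_add_I_smul_imaginaryPart X]
  simp only [Matrix.transpose_add, Matrix.transpose_smul, map_add, map_smul, ← coe_transposeHerm,
    complexify_coe, LinearMap.comp_apply]

/-- A Wigner-type theorem: one column of the complexification of `ψ` decides between the two
alternatives. -/
theorem exists_isometry_of_mapsTo_pureStates [Nonempty ι]
    (hψ : Set.MapsTo ψ (pureStates ι) (pureStates κ)) (hinj : Set.InjOn ψ (pureStates ι)) :
    ∃ U : Matrix κ ι ℂ, Uᴴ * U = 1 ∧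
      ((∀ X, (ψ X : Matrix κ κ ℂ) = U * (X : Matrix ι ι ℂ) * Uᴴ) ∨
        ∀ X, (ψ X : Matrix κ κ ℂ) = U * (X : Matrix ι ι ℂ)ᵀ * Uᴴ) := by
  obtain ⟨o, ho⟩ : ∃ o : ι → ℂ, o ⬝ᵥ star o = 1 :=
    ⟨Pi.single (Classical.arbitrary ι) 1, by simp⟩
  obtain ⟨u, hu, hou⟩ := mem_pureStates_iff.1 (hψ (outerHerm_mem_pureStates ho))
  rcases forall_exists_eq_vecMulVec_or hψ hu hou with h | h
  · obtain ⟨U, hU, hUX⟩ := exists_isometry_of_forall_exists_eq_vecMulVec_star hψ hinj ho hu hou h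
    exact ⟨U, hU, Or.inl hUX⟩
  · have hψ' : Set.MapsTo (ψ ∘ₗ transposeHerm) (pureStates ι) (pureStates κ) := fun P hP =>
      hψ (transposeHerm_mem_pureStates hP)
    have hinj' : Set.InjOn (ψ ∘ₗ transposeHerm) (pureStates ι) := fun P hP Q hQ hPQ =>
      Function.LeftInverse.injective transposeHerm_transposeHerm
        (hinj (transposeHerm_mem_pureStates hP) (transposeHerm_mem_pureStates hQ) hPQ)
    have hou' : (ψ ∘ₗ transposeHerm) (outerHerm (star o)) = outerHerm u := by
      rw [LinearMap.comp_apply, transposeHerm_outerHerm, star_star, hou]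
    obtain ⟨U, hU, hUX⟩ := exists_isometry_of_forall_exists_eq_vecMulVec_star hψ' hinj'
      (o := star o) (by rw [star_star, dotProduct_comm, ho]) hu hou' fun w => by
        obtain ⟨b, hb⟩ := h (star w)
        refine ⟨star b, ?_⟩
        rw [complexify_comp_transposeHerm, Matrix.transpose_vecMulVec, star_star,
          ← Matrix.conjTranspose_vecMulVec, ← hb, ← complexify_conjTranspose,
          Matrix.conjTranspose_vecMulVec, star_star, star_star]
    exact ⟨U, hU, Or.inr fun X => hUX (transposeHerm X)⟩

end Isometry

theorem IsUnitaryConjOrTranspose.image_pureStates {m : ℕ} {ψ : Herm (Fin m) →ₗ[ℝ] Herm (Fin m)}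
    (hψ : IsUnitaryConjOrTranspose ψ) : ψ '' pureStates (Fin m) = pureStates (Fin m) := by
  obtain ⟨U, hU, hform⟩ := hψ
  have hU' : Uᴴ * U = 1 := Matrix.mem_unitaryGroup_iff'.1 hU
  have hunit : IsUnit U.det := Matrix.isUnit_det_of_left_inverse hU'
  have hunit' : IsUnit Uᴴ.det := Matrix.isUnit_det_of_right_inverse hU'
  have hrank (X : Matrix (Fin m) (Fin m) ℂ) : (U * X * Uᴴ).rank = X.rank := by
    rw [Matrix.rank_mul_eq_left_of_isUnit_det _ _ hunit',
      Matrix.rank_mul_eq_right_of_isUnit_det _ _ hunit]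
  have htrace (X : Matrix (Fin m) (Fin m) ℂ) : (U * X * Uᴴ).trace = X.trace := by
    rw [Matrix.trace_mul_comm, ← mul_assoc, hU', one_mul]
  have hcancel (X : Matrix (Fin m) (Fin m) ℂ) : Uᴴ * (U * X * Uᴴ) * U = X := by
    rw [mul_assoc, mul_assoc, hU', mul_one, ← mul_assoc, hU', one_mul]
  have hpreimage : ψ ⁻¹' pureStates (Fin m) = pureStates (Fin m) := by
    ext X
    rcases hform with h | h <;> simp [pureStates, h, hrank, htrace]
  have hinj : Function.Injective ψ := fun X Y hXY => by
    have h := congrArg (fun Z : Herm (Fin m) => Uᴴ * (Z : Matrix (Fin m) (Fin m) ℂ) * U) hXY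
    rcases hform with hform | hform <;> simp only [hform, hcancel] at h
    · exact Subtype.ext h
    · exact Subtype.ext (Matrix.transpose_injective h)
  conv_lhs => rw [← hpreimage]
  exact Set.image_preimage_eq _ (LinearMap.injective_iff_surjective.1 hinj)

theorem castHerm_mem_pureStates {m m' : ℕ} (h : m = m') {A : Herm (Fin m)}
    (hA : A ∈ pureStates (Fin m)) : castHerm h A ∈ pureStates (Fin m') := by
  subst h
  exact hA

theorem castHerm_castHerm_symm {m m' : ℕ} (h : m = m') (A : Herm (Fin m')) :
    castHerm h (castHerm h.symm A) = A := by
  subst h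
  rfl

section Form

variable {k : ℕ} {n : Fin k → ℕ} {Ψ : Herm (ProdIdx n) →ₗ[ℝ] Herm (ProdIdx n)}

theorem image_productPureStates_of_form {π : Equiv.Perm (Fin k)} {h : ∀ i, n (π i) = n i}
    {ψ : (i : Fin k) → Herm (Fin (n i)) →ₗ[ℝ] Herm (Fin (n i))}
    (hψ : ∀ i, IsUnitaryConjOrTranspose (ψ i))
    (hΨ : ∀ A : (i : Fin k) → Herm (Fin (n i)),
      Ψ (tensorHerm A) = tensorHerm fun i => ψ i (castHerm (h i) (A (π i)))) :
    Ψ '' productPureStates n = productPureStates n := by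
  refine Set.Subset.antisymm ?_ ?_
  · rintro - ⟨_, ⟨P, hP, rfl⟩, rfl⟩
    exact ⟨_, fun i => (hψ i).image_pureStates.subset
      ⟨_, castHerm_mem_pureStates (h i) (hP (π i)), rfl⟩, hΨ P⟩
  · rintro - ⟨Q, hQ, rfl⟩
    choose P hP hPQ using fun i => (hψ i).image_pureStates.superset (hQ i)
    let A := Equiv.piCongrLeft (fun j => Herm (Fin (n j))) π fun i => castHerm (h i).symm (P i)
    have hA (i : Fin k) : A (π i) = castHerm (h i).symm (P i) :=
      Equiv.piCongrLeft_apply_apply _ _ _ _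
    refine ⟨tensorHerm A, ⟨A, π.surjective.forall.2 fun i => ?_, rfl⟩, ?_⟩
    · rw [hA]
      exact castHerm_mem_pureStates _ (hP i)
    · simp only [hΨ, hA, castHerm_castHerm_symm, hPQ]

theorem map_tensorHerm_of_forall_productState {π : Equiv.Perm (Fin k)}
    {χ : (i : Fin k) → Herm (Fin (n (π i))) →ₗ[ℝ] Herm (Fin (n i))}
    (h : ∀ p : (i : Fin k) → pureStates (Fin (n i)),
      Ψ (productState p) = tensorHerm fun i => χ i (p (π i)))
    (A : (i : Fin k) → Herm (Fin (n i))) :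
    Ψ (tensorHerm A) = tensorHerm fun i => χ i (A (π i)) := by
  let permuted : MultilinearMap ℝ (fun i => Herm (Fin (n i))) (Herm (ProdIdx n)) :=
    (MultilinearMap.domDomCongrLinearEquiv' ℝ ℝ (fun i => Herm (Fin (n i))) _ π.symm).symm
      ((tensorHermMap n).compLinearMap χ)
  have heq : Ψ.compMultilinearMap (tensorHermMap n) = permuted :=
    multilinearMap_ext_of_span_eq_top (fun i => span_pureStates) fun P hP =>
      congrArg Ψ (tensorHermMap_apply P) |>.trans <| (h fun i => ⟨P i, hP i⟩).trans
        (tensorHermMap_apply _).symm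
  exact (congrArg Ψ (tensorHermMap_apply A)).symm.trans <| congr($heq A).trans
    (tensorHermMap_apply _)

theorem exists_linearMaps_of_image_productPureStates (hn : ∀ i, 2 ≤ n i)
    (h : Ψ '' productPureStates n = productPureStates n) :
    ∃ (π : Equiv.Perm (Fin k)) (χ : (i : Fin k) → Herm (Fin (n (π i))) →ₗ[ℝ] Herm (Fin (n i))),
      (∀ i, Set.MapsTo (χ i) (pureStates _) (pureStates _)) ∧
      (∀ i, Set.InjOn (χ i) (pureStates _)) ∧
      ∀ A, Ψ (tensorHerm A) = tensorHerm fun i => χ i (A (π i)) := by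
  obtain ⟨π, φ, hφinj, hφ⟩ := exists_perm_of_image_productPureStates hn h
  have (i : Fin k) : Nontrivial (Fin (n i)) := Fin.nontrivial_iff_two_le.2 (hn i)
  have (i : Fin k) : Nontrivial (pureStates (Fin (n i))) := nontrivial_pureStates
  let p₀ (i : Fin k) : pureStates (Fin (n i)) := Classical.arbitrary _
  let χ (i : Fin k) : Herm (Fin (n (π i))) →ₗ[ℝ] Herm (Fin (n i)) :=
    partialTrace n i ∘ₗ Ψ ∘ₗ (tensorHermMap n).toLinearMap (fun j => p₀ j) (π i)
  have hχ (i : Fin k) (x : pureStates (Fin (n (π i)))) : χ i x = φ i x := by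
    change partialTrace n i (Ψ ((tensorHermMap n).toLinearMap (fun j => p₀ j) (π i) x)) = _
    rw [← productState_update, hφ, partialTrace_productState, Function.update_self]
  refine ⟨π, χ, fun i P hP => ?_, fun i P hP Q hQ hPQ => ?_,
    map_tensorHerm_of_forall_productState fun p => (hφ p).trans ?_⟩
  · rw [hχ i ⟨P, hP⟩]
    exact (φ i ⟨P, hP⟩).2
  · rw [hχ i ⟨P, hP⟩, hχ i ⟨Q, hQ⟩] at hPQ
    exact congrArg Subtype.val (hφinj i (Subtype.ext hPQ))
  · exact congrArg tensorHerm (funext fun i => (hχ i _).symm)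

theorem le_of_conjTranspose_mul_self_eq_one {m m' : ℕ} {U : Matrix (Fin m') (Fin m) ℂ}
    (h : Uᴴ * U = 1) : m ≤ m' := by
  calc m = (Uᴴ * U).rank := by rw [h, Matrix.rank_one, Fintype.card_fin]
    _ ≤ U.rank := Matrix.rank_mul_le_right Uᴴ U
    _ ≤ m' := Matrix.rank_le_height U

theorem exists_isUnitaryConjOrTranspose {m m' : ℕ} (h : m = m')
    {χ : Herm (Fin m) →ₗ[ℝ] Herm (Fin m')} {U : Matrix (Fin m') (Fin m) ℂ} (hU : Uᴴ * U = 1)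
    (hχ : (∀ X, (χ X : Matrix (Fin m') (Fin m') ℂ) = U * (X : Matrix (Fin m) (Fin m) ℂ) * Uᴴ) ∨
      ∀ X, (χ X : Matrix (Fin m') (Fin m') ℂ) = U * (X : Matrix (Fin m) (Fin m) ℂ)ᵀ * Uᴴ) :
    ∃ ψ : Herm (Fin m') →ₗ[ℝ] Herm (Fin m'), IsUnitaryConjOrTranspose ψ ∧
      ∀ X, χ X = ψ (castHerm h X) := by
  subst h
  exact ⟨χ, ⟨U, Matrix.mem_unitaryGroup_iff'.2 hU, hχ⟩, fun X => rfl⟩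

theorem exists_form_of_image_productPureStates (hn : ∀ i, 2 ≤ n i)
    (h : Ψ '' productPureStates n = productPureStates n) :
    ∃ (π : Equiv.Perm (Fin k)) (h : ∀ i, n (π i) = n i)
      (ψ : (i : Fin k) → Herm (Fin (n i)) →ₗ[ℝ] Herm (Fin (n i))),
      (∀ i, IsUnitaryConjOrTranspose (ψ i)) ∧
      ∀ A : (i : Fin k) → Herm (Fin (n i)),
        Ψ (tensorHerm A) = tensorHerm fun i => ψ i (castHerm (h i) (A (π i))) := by
  obtain ⟨π, χ, hmaps, hinj, hΨ⟩ := exists_linearMaps_of_image_productPureStates hn h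
  have (i : Fin k) : NeZero (n i) := ⟨(zero_lt_two.trans_le (hn i)).ne'⟩
  choose U hU hUχ using fun i => exists_isometry_of_mapsTo_pureStates (hmaps i) (hinj i)
  have hnπ (i : Fin k) : n (π i) = n i :=
    (Finset.sum_eq_sum_iff_of_le fun i _ => le_of_conjTranspose_mul_self_eq_one (hU i)).1
      (Equiv.sum_comp π n) i (Finset.mem_univ i)
  choose ψ hψ hχψ using fun i => exists_isUnitaryConjOrTranspose (hnπ i) (hU i) (hUχ i)
  exact ⟨π, hnπ, ψ, hψ, fun A => (hΨ A).trans (congrArg tensorHerm (funext fun i => hχψ i _))⟩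

end Form

theorem theorem3p1_general {k : ℕ} (n : Fin k → ℕ) (hn : ∀ i, 2 ≤ n i)
    (Ψ : Herm (ProdIdx n) →ₗ[ℝ] Herm (ProdIdx n)) :
    List.TFAE [
      Ψ '' productPureStates n = productPureStates n,
      Ψ '' separableStates n = separableStates n,
      ∃ (π : Equiv.Perm (Fin k)) (h : ∀ i, n (π i) = n i)
        (ψ : (i : Fin k) → Herm (Fin (n i)) →ₗ[ℝ] Herm (Fin (n i))),
        (∀ i, IsUnitaryConjOrTranspose (ψ i)) ∧
        ∀ A : (i : Fin k) → Herm (Fin (n i)),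
          Ψ (tensorHerm A) = tensorHerm fun i => ψ i (castHerm (h i) (A (π i)))] := by
  tfae_have 2 ↔ 1 := image_separableStates_eq_iff
  tfae_have 1 → 3 := exists_form_of_image_productPureStates hn
  tfae_have 3 → 1 := fun ⟨_, _, _, hψ, hΨ⟩ => image_productPureStates_of_form hψ hΨ
  tfae_finish

theorem theorem3p1 {k : ℕ} (hk : 1 < k) (n : Fin k → ℕ) (hanti : Antitone n)
    (hn : ∀ i, 2 ≤ n i) (Ψ : Herm (ProdIdx n) →ₗ[ℝ] Herm (ProdIdx n)) :
    List.TFAE [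
      Ψ '' productPureStates n = productPureStates n,
      Ψ '' separableStates n = separableStates n,
      ∃ (π : Equiv.Perm (Fin k)) (h : ∀ i, n (π i) = n i)
        (ψ : (i : Fin k) → Herm (Fin (n i)) →ₗ[ℝ] Herm (Fin (n i))),
        (∀ i, IsUnitaryConjOrTranspose (ψ i)) ∧
        ∀ A : (i : Fin k) → Herm (Fin (n i)),
          Ψ (tensorHerm A) = tensorHerm fun i => ψ i (castHerm (h i) (A (π i)))] :=
  theorem3p1_general n hn Ψ
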